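/- Let $\alpha\in(0,1)$ and set $$c_3:=\frac{\alpha(1-\alpha^2)}{6}>0,\qquad c_4:=\frac{\alpha^2(1-\alpha^2)}{8}>0 .$$ For $x\in\mathbb R$ and $y>0$ define $$\mathbf G(x,y):=\frac1{2\pi}\int_{\mathbb R}e^{ix\theta}\,e^{ic_3y\theta^3}\,e^{-c_4y\theta^4}\,d\theta$$ and $$\mathfrak g(x,y):=\frac1{2\pi}\exp\Big(-\frac{c_4x^2}{9c_3^2y}\Big)\exp\Big(i\frac{2|x|^{3/2}}{3\sqrt{3|c_3|y}}-i\frac{\pi}{4}\Big)\int_{-\sqrt{2|x|/(3|c_3|y)}}^{\sqrt{2|x|/(3|c_3|y)}}e^{-\sqrt{3|c_3||x|y}\,t^2}\,e^{c_3y\,e^{-i\pi/4}t^3}\,dt .$$ Let $y_{\min}>0$ and $\underline{\mathbf c}>0$ be given. Then there exist constants $C>0$ and $c>0$, depending only on $\alpha$, $y_{\min}$ and $\underline{\mathbf c}$, such that for all $(x,y)\in\mathbb R\times[y_{\min},+\infty)$ $$|\mathbf G(x,y)|\le\begin{cases}\dfrac{C}{y^{1/4}}\exp(-c\,x^{4/3}/y^{1/3}),&\text{if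 }x\ge\underline{\mathbf c}\,y,\\[1ex]\dfrac{C}{y^{1/3}}\exp(-c\,x^{3/2}/y^{1/2}),&\text{if }0\le x\le\underline{\mathbf c}\,y,\\[1ex]\dfrac{C}{y^{1/3}},&\text{if }-y^{1/3}\le x\le0,\\[1ex]\dfrac{C}{y^{1/4}}\exp(-c\,|x|^{4/3}/y^{1/3}),&\text{if }x\le-\underline{\mathbf c}\,y,\end{cases}$$ (where the cases overlap, all the corresponding bounds hold), and $$|\mathbf G(x,y)-2\,\mathrm{Re}\,\mathfrak g(x,y)|\le\frac{C}{y^{1/3}}\exp\Big(-c\,\frac{|x|^{3/2}}{y^{1/2}}\Big)+\frac{C}{y^{1/2}}\exp\Big(-c\,\frac{x^2}{y}\Big)\qquad\text{if }-\underline{\mathbf c}\,y\le x\le-y^{1/3}.$$ Moreover, there exist constants $\widetilde C\ge C$ and $\tilde c\in(0,c]$ such that for all $(x,y)\in\mathbb R\times[y_{\min},+\infty)$ the function $\xi\mapsto\mathbf G(\xi,y)$ is integrable on $(-\infty,x]$ and $$\left|\int_{-\infty}^x\mathbf G(\xi,y)\,d\xi\right|\le\begin{cases}\widetilde C\exp(-\tilde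 c\,|x|^{4/3}/y^{1/3}),&\text{if }x\le-\underline{\mathbf c}\,y,\\[0.5ex]\widetilde C,&\text{if }-\underline{\mathbf c}\,y\le x\le\underline{\mathbf c}\,y,\end{cases}$$ $$\left|1-\int_{-\infty}^x\mathbf G(\xi,y)\,d\xi\right|\le\widetilde C\exp(-\tilde c\,x^{4/3}/y^{1/3})\qquad\text{if }x\ge\underline{\mathbf c}\,y.$$ -/

import Mathlib

open MeasureTheory

noncomputable section

/-- The dispersion coefficient `c₃ = α (1 - α²) / 6` of the Lax-Wendroff scheme with Courant
number `α`. -/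
def lwC3 (α : ℝ) : ℝ := α * (1 - α ^ 2) / 6

/-- The dissipation coefficient `c₄ = α² (1 - α²) / 8` of the Lax-Wendroff scheme with Courant
number `α`. -/
def lwC4 (α : ℝ) : ℝ := α ^ 2 * (1 - α ^ 2) / 8

/-- The approximate Green's function
`G(x, y) = (1 / 2π) ∫_ℝ exp(i x θ) exp(i c₃ y θ³) exp(-c₄ y θ⁴) dθ`, meant for `y > 0`, where the
integral converges absolutely if `c₄ > 0`. -/
def approxGreen (c₃ c₄ x y : ℝ) : ℂ :=
  (1 / (2 * Real.pi) : ℂ) *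
    ∫ θ : ℝ, Complex.exp (Complex.I * x * θ) * Complex.exp (Complex.I * c₃ * y * (θ : ℂ) ^ 3) *
      Complex.exp (-(c₄ * y * (θ : ℂ) ^ 4))

/-- The explicit oscillating profile `𝔤(x, y)`, meant for `y > 0`. -/
def oscProfile (c₃ c₄ x y : ℝ) : ℂ :=
  (1 / (2 * Real.pi) : ℂ) * (Real.exp (-(c₄ * x ^ 2 / (9 * c₃ ^ 2 * y))) : ℂ) *
    Complex.exp (Complex.I * ((2 * |x| ^ (3 / 2 : ℝ) / (3 * √(3 * |c₃| * y)) : ℝ) : ℂ)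
      - Complex.I * (Real.pi / 4 : ℂ)) *
    ∫ t in (-√(2 * |x| / (3 * |c₃| * y)))..(√(2 * |x| / (3 * |c₃| * y))),
      (Real.exp (-(√(3 * |c₃| * |x| * y) * t ^ 2)) : ℂ) *
        Complex.exp (c₃ * y * Complex.exp (-(Complex.I * (Real.pi / 4 : ℂ))) * (t : ℂ) ^ 3)

/-- The integrand defining `approxGreen` is absolutely integrable when `c₄ > 0` and `y > 0`. -/
theorem approxGreen_integrand_integrable (c₃ c₄ x y : ℝ) (hc₄ : 0 < c₄) (hy : 0 < y) :
    Integrable (fun θ : ℝ => Complex.exp (Complex.I * x * θ) *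
      Complex.exp (Complex.I * c₃ * y * (θ : ℂ) ^ 3) *
      Complex.exp (-(c₄ * y * (θ : ℂ) ^ 4))) := by
  have hb : 0 < c₄ * y := mul_pos hc₄ hy
  have hg : Integrable (fun θ : ℝ => Real.exp (c₄ * y) * Real.exp (-(c₄ * y) * θ ^ 2)) :=
    (integrable_exp_neg_mul_sq hb).const_mul _
  refine hg.mono' (by fun_prop) (Filter.Eventually.of_forall fun θ => ?_)
  have h3 : Complex.exp (Complex.I * x * θ) * Complex.exp (Complex.I * c₃ * y * (θ : ℂ) ^ 3) *
      Complex.exp (-(c₄ * y * (θ : ℂ) ^ 4)) =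
      Complex.exp (((x * θ + c₃ * y * θ ^ 3 : ℝ) : ℂ) * Complex.I) *
        ((Real.exp (-(c₄ * y * θ ^ 4)) : ℝ) : ℂ) := by
    push_cast
    rw [← Complex.exp_add]
    congr 2
    ring
  rw [h3, norm_mul, Complex.norm_exp_ofReal_mul_I, one_mul, Complex.norm_real, Real.norm_eq_abs,
    abs_of_pos (Real.exp_pos _), ← Real.exp_add]
  apply Real.exp_le_exp.mpr
  nlinarith [mul_nonneg hb.le (sq_nonneg (θ ^ 2 - 1 / 2))]

end

noncomputable section

open Set Filter Topology Complex
open scoped Interval ComplexConjugate FourierTransform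

/-! ### Contour shifts -/

/-! The integrand defining `G` extends to the entire function `exp(i x z + i c₃ y z³ - c₄ y z⁴)`,
called `greenKernel`. It takes conjugate values at `z` and `-conj z`, so `G` is `1/π` times the real
part of the integral over the left half-line. It is also real on the imaginary axis, so moving that
half-line to any height `η` adds only an imaginary vertical piece (`approxGreen_eq_re_integral`).
Every estimate is then a choice of contour.

Outside the oscillating range a horizontal line suffices. With `|x| = y r³` bounded below by a
multiple of `y`, the height `±ε r` gains `ε y r⁴`, of the order of `|x|^(4/3) / y^(1/3)`, and the
quartic dissipation gives the width `y^(-1/4)`. For `|x| ≤ y^(1/3)` the height `ε y^(-1/3)` makes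
the cubic term Gaussian with width `y^(-1/3)`. For larger `x = y s²` up to a multiple of `y`, the
height `ε s` gains a multiple of `y s³ = x^(3/2) / y^(1/2)`.

For `x = -3 c₃ y ω²` the phase is stationary at `±ω`. The left half of the contour crosses `-ω`
along the steepest descent direction `exp(-iπ/4)`, from `-2ω + iω` to `-iω`, and is completed by a
half-line at height `ω`. The half-line contributes `exp(-2 c₃ y ω³)`. On the segment, freezing `z⁴`
at `ω⁴` in the dissipative factor gives exactly the profile, whose conjugate accounts for `+ω`. The
error `c₄ y |z⁴ - ω⁴|` is `O(y ω³ |t|)` and integrates to `O(ω²)` times an exponential in `y ω⁴`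
(`norm_approxGreen_sub_oscProfile_le`). This needs `ω` small; for larger `ω` both `G` and the
profile are separately exponentially small in `y`.

Integrating in `x` divides the kernel by `i z` on a line below the pole at `0`
(`integral_Iic_approxGreen`). The saddle contour stays below the line `re + im = 0`, hence avoids
the pole and bounds the primitive in the oscillating range. The other ranges follow by integrating
the pointwise bounds, and the total mass is `1` by Fourier inversion at `0`. -/

theorem integrableOn_Iic_of_gaussian_bound {k : ℂ → ℂ} {a p A b : ℝ} (hb : 0 < b)
    (hk : ContinuousOn (fun θ : ℝ => k (θ + p * I)) (Iic a))
    (hbound : ∀ θ ≤ a, ‖k (θ + p * I)‖ ≤ A * Real.exp (-b * θ ^ 2)) :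
    IntegrableOn (fun θ : ℝ => k (θ + p * I)) (Iic a) := by
  refine Integrable.mono' (((integrable_exp_neg_mul_sq hb).const_mul A).integrableOn)
    (hk.aestronglyMeasurable measurableSet_Iic) ?_
  exact (ae_restrict_mem measurableSet_Iic).mono fun θ hθ => hbound θ hθ

/-- Cauchy's theorem on the boundary of a left half-strip, for integrands with Gaussian decay. -/
theorem integral_boundary_left_half_strip {k : ℂ → ℂ} {a p q A b : ℝ} (hb : 0 < b)
    (hk : DifferentiableOn ℂ k (Iic a ×ℂ [[p, q]]))
    (hbound : ∀ θ ≤ a, ∀ η ∈ [[p, q]], ‖k (θ + η * I)‖ ≤ A * Real.exp (-b * θ ^ 2)) :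
    (∫ θ : ℝ in Iic a, k (θ + p * I)) - (∫ θ : ℝ in Iic a, k (θ + q * I)) +
      I * (∫ η : ℝ in p..q, k (a + η * I)) = 0 := by
  have hline : ∀ η ∈ [[p, q]], IntegrableOn (fun θ : ℝ => k (θ + η * I)) (Iic a) := by
    intro η hη
    refine integrableOn_Iic_of_gaussian_bound hb ?_ fun θ hθ => hbound θ hθ η hη
    refine hk.continuousOn.comp (by fun_prop) fun θ hθ => ?_
    rw [mem_reProdIm]
    simpa using ⟨hθ, hη⟩
  have hlim : ∀ η ∈ [[p, q]], Tendsto (fun R : ℝ => ∫ θ in R..a, k (θ + η * I)) atBot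
      (𝓝 (∫ θ : ℝ in Iic a, k (θ + η * I))) := fun η hη =>
    intervalIntegral_tendsto_integral_Iic a (hline η hη) tendsto_id
  have hside : Tendsto (fun R : ℝ => ∫ η in p..q, k (R + η * I)) atBot (𝓝 0) := by
    have h0 : Tendsto (fun R : ℝ => A * Real.exp (-b * R ^ 2) * |q - p|) atBot (𝓝 0) := by
      have h1 : Tendsto (fun R : ℝ => -b * R ^ 2) atBot atBot := by
        have : Tendsto (fun R : ℝ => R ^ 2) atBot atTop := by
          simpa [pow_two] using (tendsto_id (α := ℝ) (x := atBot)).atBot_mul_atBot₀ tendsto_id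
        exact this.const_mul_atTop_of_neg (by linarith)
      simpa using ((Real.tendsto_exp_atBot.comp h1).const_mul A).mul_const |q - p|
    refine squeeze_zero_norm' ?_ h0
    filter_upwards [eventually_le_atBot a] with R hR
    exact intervalIntegral.norm_integral_le_of_norm_le_const fun η hη =>
      hbound R hR η (uIoc_subset_uIcc hη)
  have hrect : ∀ᶠ R : ℝ in atBot, (∫ θ in R..a, k (θ + p * I)) - (∫ θ in R..a, k (θ + q * I)) +
      I * (∫ η in p..q, k (a + η * I)) - I * (∫ η in p..q, k (R + η * I)) = 0 := by
    filter_upwards [eventually_le_atBot a] with R hR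
    have h := integral_boundary_rect_eq_zero_of_differentiableOn k (R + p * I) (a + q * I) (by
      refine hk.mono ?_
      simp only [add_re, ofReal_re, mul_re, I_re, mul_zero, ofReal_im, I_im, mul_one, sub_self,
        add_zero, add_im, mul_im, zero_add]
      refine reProdIm_subset_iff.mpr (prod_mono ?_ subset_rfl)
      rw [uIcc_of_le hR]
      exact Icc_subset_Iic_self)
    simpa using h
  have hlim' := (((hlim p left_mem_uIcc).sub (hlim q right_mem_uIcc)).add_const
    (I * (∫ η : ℝ in p..q, k (a + η * I)))).sub (hside.const_mul I)
  have := tendsto_nhds_unique (hlim'.congr' hrect) tendsto_const_nhds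
  simpa using this

theorem exp_neg_I_pi_div_four :
    exp (-(I * (Real.pi / 4 : ℂ))) = ((√2 / 2 : ℝ) : ℂ) - ((√2 / 2 : ℝ) : ℂ) * I := by
  have : -(I * (Real.pi / 4 : ℂ)) = ((-(Real.pi / 4) : ℝ) : ℂ) * I := by push_cast; ring
  rw [this, exp_mul_I, ← ofReal_cos, ← ofReal_sin, Real.cos_neg, Real.sin_neg,
    Real.cos_pi_div_four, Real.sin_pi_div_four]
  push_cast; ring

/-- The half-line `(-∞, 0] - i ω` is deformed into the half-line `(-∞, -2 ω] + i ω` followed by the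
segment from `-2 ω + i ω` to `-i ω`. -/
theorem integral_left_contour {k : ℂ → ℂ} {ω A b : ℝ} (hω : 0 < ω) (hb : 0 < b)
    (hk : DifferentiableOn ℂ k {z | z.re + z.im < 0})
    (hbound : ∀ θ ≤ -(2 * ω), ∀ η ∈ [[-ω, ω]], ‖k (θ + η * I)‖ ≤ A * Real.exp (-b * θ ^ 2)) :
    ∫ θ : ℝ in Iic 0, k (θ + (-ω : ℝ) * I) = (∫ θ : ℝ in Iic (-(2 * ω)), k (θ + ω * I)) +
      ∫ t in (-(√2 * ω))..(√2 * ω), exp (-(I * (Real.pi / 4 : ℂ))) *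
        k (-ω + exp (-(I * (Real.pi / 4 : ℂ))) * t) := by
  -- Holomorphy is asked only on `re + im < 0`, which leaves room for a pole at `0`; the strip to
  -- the left of `-2ω` lies inside this half-plane.
  have hsub : Iic (-(2 * ω)) ×ℂ [[-ω, ω]] ⊆ {z : ℂ | z.re + z.im < 0} := by
    intro z hz
    rw [mem_reProdIm, uIcc_of_le (by linarith)] at hz
    have h1 : z.re ≤ -(2 * ω) := hz.1
    have h2 : z.im ≤ ω := hz.2.2
    simp only [mem_ofPred_eq]; linarith
  have hstrip := integral_boundary_left_half_strip hb (hk.mono hsub) hbound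
  have hint : IntegrableOn (fun θ : ℝ => k (θ + (-ω : ℝ) * I)) (Iic (-(2 * ω))) := by
    refine integrableOn_Iic_of_gaussian_bound hb ?_ fun θ hθ => hbound θ hθ _ left_mem_uIcc
    refine hk.continuousOn.comp (by fun_prop) fun θ hθ => ?_
    have : θ ≤ -(2 * ω) := hθ
    simp; linarith
  have hcont : ContinuousOn (fun θ : ℝ => k (θ + (-ω : ℝ) * I)) (Icc (-(2 * ω)) 0) := by
    refine hk.continuousOn.comp (by fun_prop) fun θ hθ => ?_
    have := hθ.2
    simp; linarith
  have hsplit : ∫ θ : ℝ in Iic 0, k (θ + (-ω : ℝ) * I) =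
      (∫ θ : ℝ in Iic (-(2 * ω)), k (θ + (-ω : ℝ) * I)) +
        ∫ θ in (-(2 * ω))..0, k (θ + (-ω : ℝ) * I) := by
    have hle : -(2 * ω) ≤ 0 := by linarith
    rw [intervalIntegral.integral_of_le hle, ← setIntegral_union _ measurableSet_Ioc hint
      (hcont.integrableOn_Icc.mono_set Ioc_subset_Icc_self), Iic_union_Ioc_eq_Iic hle]
    exact Set.disjoint_left.mpr fun x hx hx' => not_lt.mpr hx hx'.1
  -- The remaining triangle has vertices `-iω`, `-2ω - iω`, `-2ω + iω`. This disc contains it and is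
  -- tangent at `0` to the line `re + im = 0`, so `k` has a primitive `P` there and the three sides
  -- telescope.
  set B := Metric.ball (((-(3 * ω) : ℝ) : ℂ) + ((-(3 * ω) : ℝ) : ℂ) * I) (√18 * ω) with hB
  have hmem : ∀ z : ℂ, (z.re + 3 * ω) ^ 2 + (z.im + 3 * ω) ^ 2 < 18 * ω ^ 2 → z ∈ B := by
    intro z hz
    rw [hB, Metric.mem_ball, dist_eq_re_im, Real.sqrt_lt' (by positivity), mul_pow,
      Real.sq_sqrt (by norm_num)]
    simpa using hz
  have hBsub : B ⊆ {z : ℂ | z.re + z.im < 0} := by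
    intro z hz
    rw [hB, Metric.mem_ball, dist_eq_re_im, Real.sqrt_lt' (by positivity), mul_pow,
      Real.sq_sqrt (by norm_num)] at hz
    simp only [mem_ofPred_eq]
    simp at hz
    nlinarith [sq_nonneg (z.re - z.im)]
  obtain ⟨P, hP⟩ := (hk.mono hBsub).isExactOn_ball
  have hkB : ContinuousOn k B := hk.continuousOn.mono hBsub
  have h1 : ∫ θ in (-(2 * ω))..0, k (θ + (-ω : ℝ) * I) =
      P (((0 : ℝ) : ℂ) + (-ω : ℝ) * I) - P ((-(2 * ω) : ℝ) + (-ω : ℝ) * I) := by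
    have hm : ∀ θ ∈ [[-(2 * ω), 0]], ((θ : ℂ) + (-ω : ℝ) * I) ∈ B := by
      intro θ hθ
      rw [uIcc_of_le (by linarith)] at hθ
      apply hmem
      simp
      nlinarith [hθ.1, hθ.2]
    refine intervalIntegral.integral_eq_sub_of_hasDerivAt
      (f := fun θ : ℝ => P (θ + (-ω : ℝ) * I)) (fun θ hθ => ?_) ?_
    · have hg : HasDerivAt (fun θ : ℝ => (θ : ℂ) + (-ω : ℝ) * I) 1 θ := by
        simpa using ((hasDerivAt_id θ).ofReal_comp).add_const (((-ω : ℝ) : ℂ) * I)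
      have h := (hP _ (hm θ hθ)).comp θ hg
      rw [mul_one] at h; exact h
    · exact (hkB.comp (by fun_prop) hm).intervalIntegrable
  have h2 : I * ∫ η in (-ω)..ω, k ((-(2 * ω) : ℝ) + η * I) =
      P ((-(2 * ω) : ℝ) + (ω : ℝ) * I) - P ((-(2 * ω) : ℝ) + (-ω : ℝ) * I) := by
    have hm : ∀ η ∈ [[-ω, ω]], (((-(2 * ω) : ℝ) : ℂ) + η * I) ∈ B := by
      intro η hη
      rw [uIcc_of_le (by linarith)] at hη
      apply hmem
      simp
      nlinarith [hη.1, hη.2]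
    rw [← intervalIntegral.integral_const_mul]
    refine intervalIntegral.integral_eq_sub_of_hasDerivAt
      (f := fun η : ℝ => P ((-(2 * ω) : ℝ) + η * I)) (fun η hη => ?_) ?_
    · have hg : HasDerivAt (fun η : ℝ => ((-(2 * ω) : ℝ) : ℂ) + η * I) I η := by
        simpa using ((hasDerivAt_id η).ofReal_comp.mul_const I).const_add ((-(2 * ω) : ℝ) : ℂ)
      have h := (hP _ (hm η hη)).comp η hg
      rw [mul_comm I]; exact h
    · exact ((hkB.comp (by fun_prop) hm).const_smul I).intervalIntegrable
  have h3 : ∫ t in (-(√2 * ω))..(√2 * ω), exp (-(I * (Real.pi / 4 : ℂ))) *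
        k (-ω + exp (-(I * (Real.pi / 4 : ℂ))) * t) =
      P (((0 : ℝ) : ℂ) + (-ω : ℝ) * I) - P ((-(2 * ω) : ℝ) + (ω : ℝ) * I) := by
    set e := exp (-(I * (Real.pi / 4 : ℂ))) with he
    have hm : ∀ t ∈ [[-(√2 * ω), √2 * ω]], (-(ω : ℂ) + e * (t : ℝ)) ∈ B := by
      intro t ht
      have h2 : √2 * √2 = 2 := Real.mul_self_sqrt (by norm_num)
      rw [uIcc_of_le (by nlinarith [Real.sqrt_nonneg 2])] at ht
      apply hmem
      rw [he, exp_neg_I_pi_div_four]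
      simp
      have h4 : √2 / 2 * t ≤ ω := by nlinarith [ht.2, Real.sqrt_nonneg 2]
      have h5 : -ω ≤ √2 / 2 * t := by nlinarith [ht.1, Real.sqrt_nonneg 2]
      nlinarith
    have hend : P (((0 : ℝ) : ℂ) + (-ω : ℝ) * I) - P ((-(2 * ω) : ℝ) + (ω : ℝ) * I) =
        P (-ω + e * (√2 * ω : ℝ)) - P (-ω + e * (-(√2 * ω) : ℝ)) := by
      have h2 : ((√2 : ℝ) : ℂ) ^ 2 = 2 := by
        rw [← ofReal_pow, Real.sq_sqrt (by norm_num)]; norm_num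
      congr 2
      · rw [he, exp_neg_I_pi_div_four]; push_cast
        linear_combination (-ω / 2 + ω / 2 * I : ℂ) * h2
      · rw [he, exp_neg_I_pi_div_four]; push_cast
        linear_combination (ω / 2 - ω / 2 * I : ℂ) * h2
    rw [hend]
    refine intervalIntegral.integral_eq_sub_of_hasDerivAt
      (f := fun t : ℝ => P (-ω + e * t)) (fun t ht => ?_) ?_
    · have hg : HasDerivAt (fun t : ℝ => -(ω : ℂ) + e * t) e t := by
        simpa using ((hasDerivAt_id t).ofReal_comp.const_mul e).const_add (-(ω : ℂ))
      have h := (hP _ (hm t ht)).comp t hg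
      rw [mul_comm]; exact h
    · exact ((hkB.comp (by fun_prop) hm).const_smul e).intervalIntegrable
  rw [hsplit, h3, h1]
  rw [h2] at hstrip
  linear_combination hstrip

/-! ### The analytic integrand of the approximate Green's function -/

/-- The entire function whose integral over the real line defines `approxGreen`. -/
def greenKernel (c₃ c₄ x y : ℝ) (z : ℂ) : ℂ :=
  exp (I * x * z + I * c₃ * y * z ^ 3 - c₄ * y * z ^ 4)

/-- The real part of the exponent of `greenKernel` at `θ + i η`. -/
def greenExponent (c₃ c₄ x y θ η : ℝ) : ℝ :=
  -(x * η) + c₃ * y * (η ^ 3 - 3 * θ ^ 2 * η) - c₄ * y * (θ ^ 4 - 6 * θ ^ 2 * η ^ 2 + η ^ 4)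

theorem norm_greenKernel (c₃ c₄ x y θ η : ℝ) :
    ‖greenKernel c₃ c₄ x y (θ + η * I)‖ = Real.exp (greenExponent c₃ c₄ x y θ η) := by
  rw [greenKernel, norm_exp]
  congr 1
  have h : I * x * (θ + η * I) + I * c₃ * y * (θ + η * I : ℂ) ^ 3 - c₄ * y * (θ + η * I : ℂ) ^ 4 =
      ((greenExponent c₃ c₄ x y θ η : ℝ) : ℂ) + ((x * θ + c₃ * y * (θ ^ 3 - 3 * θ * η ^ 2)
        - c₄ * y * (4 * θ ^ 3 * η - 4 * θ * η ^ 3) : ℝ) : ℂ) * I := by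
    rw [greenExponent]
    push_cast
    linear_combination (x * η + c₃ * y * (3 * θ ^ 2 * η + 3 * θ * η ^ 2 * I + η ^ 3 * (I ^ 2 - 1))
      - c₄ * y * (6 * θ ^ 2 * η ^ 2 + 4 * θ * η ^ 3 * I + η ^ 4 * (I ^ 2 - 1)) : ℂ) * I_sq
  rw [h, add_re, ofReal_re, re_ofReal_mul, I_re, mul_zero, add_zero]

theorem differentiable_greenKernel (c₃ c₄ x y : ℝ) : Differentiable ℂ (greenKernel c₃ c₄ x y) := by
  unfold greenKernel; fun_prop

theorem continuous_greenKernel (c₃ c₄ x y : ℝ) : Continuous (greenKernel c₃ c₄ x y) :=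
  (differentiable_greenKernel c₃ c₄ x y).continuous

/-- This symmetry folds the right half-line onto the left one and makes the kernel real on the
imaginary axis. -/
theorem greenKernel_neg_conj (c₃ c₄ x y : ℝ) (z : ℂ) :
    greenKernel c₃ c₄ x y (-conj z) = conj (greenKernel c₃ c₄ x y z) := by
  rw [greenKernel, greenKernel, ← exp_conj]
  congr 1
  simp only [map_add, map_sub, map_mul, map_pow, conj_I, conj_ofReal]
  ring

/-- On a horizontal strip, `greenKernel` has Gaussian decay. -/
theorem exists_norm_greenKernel_le {c₃ c₄ y : ℝ} (hc₃ : 0 < c₃) (hc₄ : 0 < c₄) (hy : 0 < y)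
    (x M : ℝ) : ∃ A : ℝ, ∀ θ η : ℝ, |η| ≤ M →
      ‖greenKernel c₃ c₄ x y (θ + η * I)‖ ≤ A * Real.exp (-1 * θ ^ 2) := by
  -- `B` collects the coefficients of `θ²` on the strip; the extra `1` pays for the factor
  -- `exp(-θ²)`, and the quartic term absorbs `B θ²`.
  set B := 3 * c₃ * y * M + 6 * c₄ * y * M ^ 2 + 1 with hB
  refine ⟨Real.exp (|x| * M + c₃ * y * M ^ 3 + B ^ 2 / (4 * (c₄ * y))), fun θ η hη => ?_⟩
  rw [norm_greenKernel, ← Real.exp_add, Real.exp_le_exp, greenExponent]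
  have hM : 0 ≤ M := (abs_nonneg η).trans hη
  have h1 : -(x * η) ≤ |x| * M := by
    calc -(x * η) ≤ |x * η| := neg_le_abs _
      _ = |x| * |η| := abs_mul _ _
      _ ≤ |x| * M := by gcongr
  have h2 : η ^ 3 ≤ M ^ 3 := by
    calc η ^ 3 ≤ |η ^ 3| := le_abs_self _
      _ = |η| ^ 3 := abs_pow _ _
      _ ≤ M ^ 3 := by gcongr
  have h3 : -η ≤ M := (neg_le_abs η).trans hη
  have h4 : η ^ 2 ≤ M ^ 2 := by
    rw [← sq_abs]; gcongr
  have h5 : c₃ * y * η ^ 3 ≤ c₃ * y * M ^ 3 := by gcongr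
  have h6 : 3 * c₃ * y * θ ^ 2 * (-η) ≤ 3 * c₃ * y * θ ^ 2 * M := by gcongr
  have h7 : 6 * c₄ * y * θ ^ 2 * η ^ 2 ≤ 6 * c₄ * y * θ ^ 2 * M ^ 2 := by gcongr
  have h8 : 0 ≤ c₄ * y * η ^ 4 := by positivity
  have h9 : B * θ ^ 2 - c₄ * y * θ ^ 4 ≤ B ^ 2 / (4 * (c₄ * y)) := by
    have := mul_pos hc₄ hy
    rw [le_div_iff₀ (by positivity)]
    nlinarith [sq_nonneg (B - 2 * (c₄ * y) * θ ^ 2)]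
  have h10 : B * θ ^ 2 = 3 * c₃ * y * θ ^ 2 * M + 6 * c₄ * y * θ ^ 2 * M ^ 2 + θ ^ 2 := by
    rw [hB]; ring
  nlinarith

theorem integrable_greenKernel {c₃ c₄ y : ℝ} (hc₃ : 0 < c₃) (hc₄ : 0 < c₄) (hy : 0 < y)
    (x η : ℝ) : Integrable (fun θ : ℝ => greenKernel c₃ c₄ x y (θ + η * I)) := by
  obtain ⟨A, hA⟩ := exists_norm_greenKernel_le hc₃ hc₄ hy x |η|
  refine Integrable.mono' ((integrable_exp_neg_mul_sq one_pos).const_mul A)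
    (((continuous_greenKernel c₃ c₄ x y).comp (by fun_prop)).aestronglyMeasurable) ?_
  exact Eventually.of_forall fun θ => hA θ η le_rfl

theorem approxGreen_eq_integral_greenKernel (c₃ c₄ x y : ℝ) :
    approxGreen c₃ c₄ x y = (1 / (2 * Real.pi) : ℂ) * ∫ θ : ℝ, greenKernel c₃ c₄ x y θ := by
  rw [approxGreen]
  congr 2
  ext θ
  rw [greenKernel, ← exp_add, ← exp_add]
  congr 1

/-- The Green's function as the real part of an integral over any horizontal half-line. -/
theorem approxGreen_eq_re_integral {c₃ c₄ y : ℝ} (hc₃ : 0 < c₃) (hc₄ : 0 < c₄) (hy : 0 < y)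
    (x η : ℝ) : approxGreen c₃ c₄ x y =
      ((1 / Real.pi * (∫ θ : ℝ in Iic 0, greenKernel c₃ c₄ x y (θ + η * I)).re : ℝ) : ℂ) := by
  set k := greenKernel c₃ c₄ x y with hk
  have hint : Integrable (fun θ : ℝ => k θ) := by
    simpa using integrable_greenKernel hc₃ hc₄ hy x 0
  have hright : ∫ θ : ℝ in Ioi 0, k θ = conj (∫ θ : ℝ in Iic 0, k θ) := by
    have h := integral_comp_neg_Iic 0 (fun θ : ℝ => k θ)
    rw [neg_zero] at h
    rw [← h, ← integral_conj]
    congr 1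
    ext θ
    rw [hk, ← greenKernel_neg_conj]
    simp
  have hline : ∫ θ : ℝ, k θ = ((2 * (∫ θ : ℝ in Iic 0, k θ).re : ℝ) : ℂ) := by
    rw [← intervalIntegral.integral_Iic_add_Ioi (b := 0) hint.integrableOn hint.integrableOn,
      hright, add_conj]
  have hshift : (∫ θ : ℝ in Iic 0, k θ).re = (∫ θ : ℝ in Iic 0, k (θ + η * I)).re := by
    obtain ⟨A, hA⟩ := exists_norm_greenKernel_le hc₃ hc₄ hy x |η|
    have h := integral_boundary_left_half_strip (k := k) (a := 0) (p := 0) (q := η) one_pos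
      (differentiable_greenKernel c₃ c₄ x y).differentiableOn (fun θ _ t ht => hA θ t (by
        have := abs_sub_left_of_mem_uIcc ht
        simpa using this))
    have hreal : ∀ t : ℝ, k ((0 : ℝ) + t * I) = (((k ((0 : ℝ) + t * I)).re : ℝ) : ℂ) := by
      intro t
      refine (conj_eq_iff_re.mp ?_).symm
      rw [hk, ← greenKernel_neg_conj]
      congr 1
      simp
    -- The kernel is real on the vertical side and `dz = i dt`, so this side disappears from the
    -- real part.
    have hvert : (I * ∫ t in (0 : ℝ)..η, k ((0 : ℝ) + t * I)).re = 0 := by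
      rw [intervalIntegral.integral_congr fun t _ => hreal t, intervalIntegral.integral_ofReal]
      simp
    have := congrArg re h
    simp only [add_re, sub_re, hvert] at this
    simp only [ofReal_zero, zero_mul, add_zero, zero_re] at this
    linarith
  rw [approxGreen_eq_integral_greenKernel, ← hk, hline, hshift]
  push_cast
  field_simp

/-! ### Gaussian majorants on horizontal lines. -/

theorem norm_setIntegral_le_gaussian {g : ℝ → ℂ} {s : Set ℝ} (hs : MeasurableSet s) {A b : ℝ}
    (hA : 0 ≤ A) (hb : 0 < b) (h : ∀ θ ∈ s, ‖g θ‖ ≤ A * Real.exp (-b * θ ^ 2)) :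
    ‖∫ θ in s, g θ‖ ≤ A * √(Real.pi / b) := by
  have hint := (integrable_exp_neg_mul_sq hb).const_mul A
  calc ‖∫ θ in s, g θ‖ ≤ ∫ θ in s, A * Real.exp (-b * θ ^ 2) :=
        norm_integral_le_of_norm_le hint.integrableOn
          ((ae_restrict_mem hs).mono fun θ hθ => h θ hθ)
    _ ≤ ∫ θ, A * Real.exp (-b * θ ^ 2) :=
        setIntegral_le_integral hint (Eventually.of_forall fun θ => by positivity)
    _ = A * √(Real.pi / b) := by rw [integral_const_mul, integral_gaussian]

theorem norm_approxGreen_le_of_re {c₃ c₄ y : ℝ} (hc₃ : 0 < c₃) (hc₄ : 0 < c₄) (hy : 0 < y)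
    (x η : ℝ) : ‖approxGreen c₃ c₄ x y‖ ≤
      1 / Real.pi * ‖∫ θ : ℝ in Iic 0, greenKernel c₃ c₄ x y (θ + η * I)‖ := by
  rw [approxGreen_eq_re_integral hc₃ hc₄ hy x η, norm_real, norm_mul,
    Real.norm_of_nonneg (by positivity)]
  gcongr
  exact abs_re_le_norm _

theorem sqrt_pi_div_le {b : ℝ} : √(Real.pi / b) ≤ 2 / √b := by
  rw [Real.sqrt_div Real.pi_pos.le]
  gcongr
  rw [Real.sqrt_le_left (by norm_num)]
  linarith [Real.pi_le_four]

/-- Reduces a pointwise bound to the choice of a height `η`: `D` is the gain in the exponent, `b`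
the Gaussian rate. The factors `1/π ≤ 1/2` and `√(π/b) ≤ 2/√b` leave the constant `1`. -/
theorem norm_approxGreen_le_of_exponent_le {c₃ c₄ x y η D b : ℝ} (hc₃ : 0 < c₃) (hc₄ : 0 < c₄)
    (hy : 0 < y) (hb : 0 < b) (h : ∀ θ, greenExponent c₃ c₄ x y θ η ≤ -D - b * θ ^ 2) :
    ‖approxGreen c₃ c₄ x y‖ ≤ Real.exp (-D) / √b := by
  have h1 : ‖∫ θ : ℝ in Iic 0, greenKernel c₃ c₄ x y (θ + η * I)‖ ≤
      Real.exp (-D) * √(Real.pi / b) :=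
    norm_setIntegral_le_gaussian measurableSet_Iic (Real.exp_pos _).le hb fun θ _ => by
      rw [norm_greenKernel, ← Real.exp_add, Real.exp_le_exp]
      linarith [h θ]
  have h2 : 1 / Real.pi ≤ 1 / 2 := by
    have := Real.pi_gt_three
    gcongr; linarith
  calc ‖approxGreen c₃ c₄ x y‖ ≤ 1 / Real.pi * (Real.exp (-D) * √(Real.pi / b)) :=
        (norm_approxGreen_le_of_re hc₃ hc₄ hy x η).trans (by gcongr)
    _ ≤ 1 / 2 * (Real.exp (-D) * (2 / √b)) := by
        gcongr
        exact sqrt_pi_div_le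
    _ = Real.exp (-D) / √b := by ring

/-! ### Pointwise bounds from horizontal contour shifts -/

/-- The substitutions `x = y r³`, `x = y s²`, and later `y = q³`, turn the fractional powers of the
statement into monomials. -/
theorem mul_cube_rpow_div {y r : ℝ} (hy : 0 < y) (hr : 0 ≤ r) :
    (y * r ^ 3) ^ (4 / 3 : ℝ) / y ^ (1 / 3 : ℝ) = y * r ^ 4 := by
  rw [Real.mul_rpow hy.le (by positivity), mul_div_right_comm, ← Real.rpow_sub hy,
    ← Real.rpow_natCast r 3, ← Real.rpow_mul hr]
  norm_num

theorem mul_sq_rpow_div {y s : ℝ} (hy : 0 < y) (hs : 0 ≤ s) :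
    (y * s ^ 2) ^ (3 / 2 : ℝ) / y ^ (1 / 2 : ℝ) = y * s ^ 3 := by
  rw [Real.mul_rpow hy.le (by positivity), mul_div_right_comm, ← Real.rpow_sub hy,
    ← Real.rpow_natCast s 2, ← Real.rpow_mul hs]
  norm_num

theorem exists_eq_mul_cube {X y : ℝ} (hX : 0 ≤ X) (hy : 0 < y) : ∃ r, 0 ≤ r ∧ X = y * r ^ 3 := by
  refine ⟨(X / y) ^ (1 / 3 : ℝ), by positivity, ?_⟩
  rw [← Real.rpow_natCast, ← Real.rpow_mul (by positivity)]
  norm_num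
  field_simp

theorem exists_eq_mul_sq {X y : ℝ} (hX : 0 ≤ X) (hy : 0 < y) : ∃ s, 0 ≤ s ∧ X = y * s ^ 2 := by
  refine ⟨√(X / y), by positivity, ?_⟩
  rw [Real.sq_sqrt (by positivity)]
  field_simp

theorem sqrt_sqrt_eq_rpow {y : ℝ} (hy : 0 ≤ y) : √(√y) = y ^ (1 / 4 : ℝ) := by
  rw [Real.sqrt_eq_rpow, Real.sqrt_eq_rpow, ← Real.rpow_mul hy]
  norm_num

/-- Since `√(b y) θ² ≤ b y θ⁴ + 1/4`, quartic decay is Gaussian decay of rate `√(b y)` up to the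
factor `exp(1/4)`. -/
theorem norm_approxGreen_le_of_exponent_le_quartic {c₃ c₄ x y η D b : ℝ} (hc₃ : 0 < c₃)
    (hc₄ : 0 < c₄) (hy : 0 < y) (hb : 0 < b)
    (h : ∀ θ, greenExponent c₃ c₄ x y θ η ≤ -D - b * y * θ ^ 4) :
    ‖approxGreen c₃ c₄ x y‖ ≤ (Real.exp (1 / 4) / b ^ (1 / 4 : ℝ)) / y ^ (1 / 4 : ℝ) *
      Real.exp (-D) := by
  have hby : 0 < b * y := mul_pos hb hy
  refine (norm_approxGreen_le_of_exponent_le (D := D - 1 / 4) (b := √(b * y)) hc₃ hc₄ hy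
    (Real.sqrt_pos.mpr hby) fun θ => (h θ).trans ?_).trans_eq ?_
  · have h2 : √(b * y) ^ 2 = b * y := Real.sq_sqrt hby.le
    have h3 : (√(b * y) * θ ^ 2) ^ 2 = b * y * θ ^ 4 := by rw [mul_pow, h2]; ring
    linarith [sq_nonneg (√(b * y) * θ ^ 2 - 1 / 2), h3]
  · rw [sqrt_sqrt_eq_rpow hby.le, Real.mul_rpow hb.le hy.le, neg_sub, sub_eq_add_neg,
      Real.exp_add]
    field_simp

/-- The gain is linear in `ε`, while every loss is at most a term of `K ε² r⁴` plus a part of `c₄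
θ⁴`. The bound `r ≥ r₀` lets the fourth power of `r` dominate the lower powers coming from the cubic
phase. -/
theorem greenExponent_le_outer {c₃ c₄ y r ε σ K r₀ θ : ℝ} (hc₃ : 0 < c₃) (hc₄ : 0 < c₄)
    (hy : 0 < y) (hr₀ : 0 < r₀) (hr : r₀ ≤ r) (hε : 0 < ε) (hε₁ : ε ≤ 1) (hσ : σ = 1 ∨ σ = -1)
    (hK : K = c₃ / r₀ + 9 * c₃ ^ 2 / (c₄ * r₀ ^ 2) + 17 * c₄) (hεK : ε * K ≤ 1 / 2) :
    greenExponent c₃ c₄ (σ * (y * r ^ 3)) y θ (σ * (ε * r)) ≤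
      -(ε / 2 * (y * r ^ 4)) - c₄ / 4 * y * θ ^ 4 := by
  have hr' : 0 < r := hr₀.trans_le hr
  have e1 : greenExponent c₃ c₄ (σ * (y * r ^ 3)) y θ (σ * (ε * r)) ≤
      y * (-(ε * r ^ 4) + c₃ * ε ^ 3 * r ^ 3 + 3 * c₃ * θ ^ 2 * ε * r
        - c₄ * (θ ^ 4 - 6 * θ ^ 2 * (ε * r) ^ 2 + (ε * r) ^ 4)) := by
    have p1 : 0 ≤ y * (c₃ * ε ^ 3 * r ^ 3) := by positivity
    have p2 : 0 ≤ y * (3 * c₃ * θ ^ 2 * ε * r) := by positivity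
    rcases hσ with rfl | rfl <;> rw [greenExponent] <;> nlinarith
  have e2 : c₃ * ε ^ 3 * r ^ 3 ≤ c₃ / r₀ * ε ^ 2 * r ^ 4 := by
    have h1 : ε ^ 3 ≤ ε ^ 2 := pow_le_pow_of_le_one hε.le hε₁ (by norm_num)
    have h2 : r ^ 3 ≤ r ^ 4 / r₀ := by
      rw [le_div_iff₀ hr₀]
      nlinarith [pow_pos hr' 3]
    calc c₃ * ε ^ 3 * r ^ 3 ≤ c₃ * ε ^ 2 * (r ^ 4 / r₀) := by gcongr
      _ = c₃ / r₀ * ε ^ 2 * r ^ 4 := by ring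
  have e3 : 3 * c₃ * θ ^ 2 * ε * r ≤ c₄ / 4 * θ ^ 4 +
      9 * c₃ ^ 2 / (c₄ * r₀ ^ 2) * ε ^ 2 * r ^ 4 := by
    have h2 : r ^ 2 ≤ r ^ 4 / r₀ ^ 2 := by
      rw [le_div_iff₀ (by positivity)]
      have : r₀ ^ 2 ≤ r ^ 2 := by gcongr
      nlinarith [pow_pos hr' 2]
    calc 3 * c₃ * θ ^ 2 * ε * r
        ≤ c₄ / 4 * θ ^ 4 + 9 * c₃ ^ 2 / c₄ * ε ^ 2 * r ^ 2 := by
          have h3 : 0 ≤ c₄ * (θ ^ 2 / 2 - 3 * c₃ / c₄ * ε * r) ^ 2 := by positivity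
          have h4 : c₄ * (θ ^ 2 / 2 - 3 * c₃ / c₄ * ε * r) ^ 2 = c₄ / 4 * θ ^ 4 +
            9 * c₃ ^ 2 / c₄ * ε ^ 2 * r ^ 2 - 3 * c₃ * θ ^ 2 * ε * r := by field_simp; ring
          linarith
      _ ≤ c₄ / 4 * θ ^ 4 + 9 * c₃ ^ 2 / c₄ * ε ^ 2 * (r ^ 4 / r₀ ^ 2) := by gcongr
      _ = _ := by field_simp
  have e4 : - (c₄ * (θ ^ 4 - 6 * θ ^ 2 * (ε * r) ^ 2 + (ε * r) ^ 4)) ≤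
      -(c₄ / 2 * θ ^ 4) + 17 * c₄ * ε ^ 2 * r ^ 4 := by
    have h1 : ε ^ 4 ≤ ε ^ 2 := pow_le_pow_of_le_one hε.le hε₁ (by norm_num)
    have h2 : 17 * c₄ * ε ^ 4 * r ^ 4 ≤ 17 * c₄ * ε ^ 2 * r ^ 4 := by gcongr
    have h3 : 0 ≤ c₄ / 2 * (θ ^ 2 - 6 * (ε * r) ^ 2) ^ 2 := by positivity
    nlinarith
  have e5 : ε * (ε * K) * r ^ 4 ≤ ε * (1 / 2) * r ^ 4 := by gcongr
  rw [hK] at e5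
  refine e1.trans ?_
  have : -(ε / 2 * (y * r ^ 4)) - c₄ / 4 * y * θ ^ 4 =
      y * (-(ε / 2 * r ^ 4) - c₄ / 4 * θ ^ 4) := by ring
  rw [this]
  refine mul_le_mul_of_nonneg_left ?_ hy.le
  linarith

theorem mul_abs_le_rpow_div {r₀ ξ y : ℝ} (hr₀ : 0 ≤ r₀) (hy : 0 < y) (h : r₀ ^ 3 * y ≤ |ξ|) :
    r₀ * |ξ| ≤ |ξ| ^ (4 / 3 : ℝ) / y ^ (1 / 3 : ℝ) := by
  obtain ⟨r, hr, hxr⟩ := exists_eq_mul_cube (abs_nonneg ξ) hy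
  have hrr : r₀ ≤ r := by
    rw [hxr, mul_comm y] at h
    exact (pow_le_pow_iff_left₀ hr₀ hr (by norm_num)).mp (le_of_mul_le_mul_right h hy)
  rw [hxr, mul_cube_rpow_div hy hr]
  have : r₀ * (y * r ^ 3) ≤ r * (y * r ^ 3) := by gcongr
  linarith

theorem exists_pos_cube_eq {a : ℝ} (ha : 0 < a) : ∃ r, 0 < r ∧ a = r ^ 3 := by
  obtain ⟨r, hr, har⟩ := exists_eq_mul_cube ha.le one_pos
  rw [one_mul] at har
  refine ⟨r, hr.lt_of_ne fun h => ?_, har⟩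
  rw [← h] at har
  norm_num at har
  exact ha.ne' har

/-- Super-exponential decay in the range `|x| ≥ c̄ y`. -/
theorem exists_norm_approxGreen_le_outer {c₃ c₄ cbar : ℝ} (hc₃ : 0 < c₃) (hc₄ : 0 < c₄)
    (hcbar : 0 < cbar) : ∃ C > 0, ∃ c > 0, ∀ x y : ℝ, 0 < y → cbar * y ≤ |x| →
      ‖approxGreen c₃ c₄ x y‖ ≤
        C / y ^ (1 / 4 : ℝ) * Real.exp (-(c * (|x| ^ (4 / 3 : ℝ) / y ^ (1 / 3 : ℝ)))) := by
  obtain ⟨r₀, hr₀, hcr⟩ := exists_pos_cube_eq hcbar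
  set K := c₃ / r₀ + 9 * c₃ ^ 2 / (c₄ * r₀ ^ 2) + 17 * c₄ with hK
  have hKpos : 0 < K := by positivity
  set ε := 1 / (2 * K + 1) with hε
  have hεpos : 0 < ε := by positivity
  have hε₁ : ε ≤ 1 := by rw [hε, div_le_one (by positivity)]; linarith
  have hεK : ε * K ≤ 1 / 2 := by
    rw [hε, div_mul_eq_mul_div, div_le_div_iff₀ (by positivity) (by norm_num)]; linarith
  refine ⟨Real.exp (1 / 4) / (c₄ / 4) ^ (1 / 4 : ℝ), by positivity, ε / 2, by positivity,
    fun x y hy hx => ?_⟩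
  obtain ⟨r, hr, hxr⟩ := exists_eq_mul_cube (abs_nonneg x) hy
  have hrr : r₀ ≤ r := by
    rw [hxr, hcr, mul_comm y] at hx
    exact (pow_le_pow_iff_left₀ hr₀.le hr (by norm_num)).mp (le_of_mul_le_mul_right hx hy)
  obtain ⟨σ, hσ, hxσ⟩ : ∃ σ : ℝ, (σ = 1 ∨ σ = -1) ∧ x = σ * (y * r ^ 3) := by
    rcases abs_choice x with h | h
    · exact ⟨1, Or.inl rfl, by linarith⟩
    · exact ⟨-1, Or.inr rfl, by linarith⟩
  rw [hxr, mul_cube_rpow_div hy hr, hxσ]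
  exact norm_approxGreen_le_of_exponent_le_quartic (η := σ * (ε * r)) hc₃ hc₄ hy (by positivity)
    fun θ => greenExponent_le_outer hc₃ hc₄ hy hr₀ hrr hεpos hε₁ hσ hK hεK

/-- The bound in the Airy range `|x| ≤ q` with `q = y ^ (1 / 3)`. -/
theorem exists_norm_approxGreen_le_airy {c₃ c₄ q₀ : ℝ} (hc₃ : 0 < c₃) (hc₄ : 0 < c₄)
    (hq₀ : 0 < q₀) : ∃ C > 0, ∀ x q : ℝ, q₀ ≤ q → |x| ≤ q →
      ‖approxGreen c₃ c₄ x (q ^ 3)‖ ≤ C / q := by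
  -- The second entry keeps the cross term `6 c₄ y θ² η²` below two thirds of the Gaussian term `3
  -- c₃ y θ² η`; this is where a lower bound on `q` enters.
  set ε := min 1 (c₃ * q₀ / (3 * c₄)) with hε
  have hεpos : 0 < ε := lt_min one_pos (by positivity)
  have hε₁ : ε ≤ 1 := min_le_left _ _
  have hε₂ : ε * (3 * c₄) ≤ c₃ * q₀ := (le_div_iff₀ (by positivity)).mp (min_le_right _ _)
  refine ⟨Real.exp (1 + c₃) / √(c₃ * ε), by positivity, fun x q hq hx => ?_⟩
  have hqpos : 0 < q := hq₀.trans_le hq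
  have h := norm_approxGreen_le_of_exponent_le (c₃ := c₃) (c₄ := c₄) (x := x) (y := q ^ 3)
    (η := ε / q) (D := -(1 + c₃)) (b := c₃ * ε * q ^ 2) hc₃ hc₄ (by positivity) (by positivity)
    fun θ => by
      have e1 : -(x * (ε / q)) ≤ 1 := by
        have : -x * ε ≤ q * 1 := by
          have := neg_le_abs x
          exact mul_le_mul (by linarith) hε₁ hεpos.le hqpos.le
        rw [← neg_mul, mul_div_assoc', div_le_one hqpos]
        linarith
      have e2 : c₃ * q ^ 3 * ((ε / q) ^ 3 - 3 * θ ^ 2 * (ε / q)) =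
          c₃ * ε ^ 3 - 3 * (c₃ * ε * q ^ 2 * θ ^ 2) := by field_simp
      have e3 : c₄ * q ^ 3 * (θ ^ 4 - 6 * θ ^ 2 * (ε / q) ^ 2 + (ε / q) ^ 4) =
          c₄ * q ^ 3 * (θ ^ 4 + (ε / q) ^ 4) - 2 * q * ε * θ ^ 2 * (ε * (3 * c₄)) := by
        field_simp
        ring
      have e4 : 2 * q * ε * θ ^ 2 * (ε * (3 * c₄)) ≤ 2 * q * ε * θ ^ 2 * (c₃ * q) := by
        exact mul_le_mul_of_nonneg_left (hε₂.trans (by gcongr)) (by positivity)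
      have e5 : 0 ≤ c₄ * q ^ 3 * (θ ^ 4 + (ε / q) ^ 4) := by positivity
      have e6 : c₃ * ε ^ 3 ≤ c₃ := mul_le_of_le_one_right hc₃.le (pow_le_one₀ hεpos.le hε₁)
      rw [greenExponent, e2, e3]
      linarith
  rw [Real.sqrt_mul (by positivity), Real.sqrt_sq hqpos.le, neg_neg, ← div_div] at h
  exact h

/-- The bound in the range `q ≤ x ≤ c̄ y` with `q = y ^ (1 / 3)`. -/
theorem exists_norm_approxGreen_le_right {c₃ c₄ cbar : ℝ} (hc₃ : 0 < c₃) (hc₄ : 0 < c₄)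
    (hcbar : 0 < cbar) : ∃ C > 0, ∃ c > 0, ∀ s q : ℝ, 0 < q → 0 ≤ s → 1 ≤ q * s →
      s ^ 2 ≤ cbar →
      ‖approxGreen c₃ c₄ (q ^ 3 * s ^ 2) (q ^ 3)‖ ≤ C / q * Real.exp (-(c * (q ^ 3 * s ^ 3))) := by
  -- The first two entries give `c₃ ε² ≤ 1/2`, so the cubic term costs at most half of the gain; the
  -- third controls the cross term `6 c₄ y θ² η²` for `s ≤ √cbar`.
  set ε := min (1 / (2 * c₃ + 1)) (min 1 (c₃ / (3 * c₄ * √cbar))) with hε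
  have hεpos : 0 < ε := lt_min (by positivity) (lt_min one_pos (by positivity))
  have hε₁ : ε ≤ 1 := (min_le_right _ _).trans (min_le_left _ _)
  have hε₂ : ε * (2 * c₃ + 1) ≤ 1 := (le_div_iff₀ (by positivity)).mp (min_le_left _ _)
  have hε₃ : ε * (3 * c₄ * √cbar) ≤ c₃ :=
    (le_div_iff₀ (by positivity)).mp ((min_le_right _ _).trans (min_le_right _ _))
  refine ⟨1 / √(c₃ * ε), by positivity, ε / 2, by positivity, fun s q hq hs hqs hsc => ?_⟩
  have hs' : s ≤ √cbar := Real.le_sqrt_of_sq_le hsc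
  have hspos : 0 < s := by
    rcases hs.lt_or_eq with h | h
    · exact h
    · rw [← h] at hqs; norm_num at hqs
  have h := norm_approxGreen_le_of_exponent_le (c₃ := c₃) (c₄ := c₄) (x := q ^ 3 * s ^ 2)
    (y := q ^ 3) (η := ε * s) (D := ε / 2 * (q ^ 3 * s ^ 3)) (b := c₃ * ε * (q ^ 3 * s)) hc₃ hc₄
    (by positivity) (by positivity) fun θ => by
      have e4 : 2 * q ^ 3 * s * ε * θ ^ 2 * (ε * (3 * c₄ * s)) ≤ 2 * q ^ 3 * s * ε * θ ^ 2 * c₃ := by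
        gcongr
        exact le_trans (by gcongr) hε₃
      have e5 : 0 ≤ c₄ * q ^ 3 * (θ ^ 4 + (ε * s) ^ 4) := by positivity
      have e6 : c₃ * ε ^ 2 ≤ 1 / 2 := by nlinarith
      have e7 : ε * q ^ 3 * s ^ 3 * (c₃ * ε ^ 2) ≤ ε * q ^ 3 * s ^ 3 * (1 / 2) := by gcongr
      rw [greenExponent]
      nlinarith
  refine h.trans ?_
  -- Because `q s ≥ 1`, the Gaussian rate is at least of order `q²`, whence the prefactor `1/q`.
  have hq2 : q ^ 2 ≤ q ^ 3 * s := by nlinarith [pow_pos hq 2]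
  have : √(c₃ * ε) * q ≤ √(c₃ * ε * (q ^ 3 * s)) := by
    rw [← Real.sqrt_sq hq.le, ← Real.sqrt_mul (by positivity)]
    apply Real.sqrt_le_sqrt
    rw [Real.sqrt_sq hq.le]
    gcongr
  rw [div_div, one_div_mul_eq_div]
  gcongr

/-! ### The oscillating range: contour through the saddle points -/

/-- `greenKernel` at `-ω + exp (-i π / 4) t` without the dissipative factor, where `-ω` is a
stationary point of the phase. -/
def saddleAmplitude (c₃ y ω t : ℝ) : ℂ :=
  exp (2 * I * c₃ * y * ω ^ 3 - 3 * c₃ * y * ω * t ^ 2 +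
    c₃ * y * exp (-(I * (Real.pi / 4 : ℂ))) * (t : ℂ) ^ 3)

theorem exp_neg_I_pi_div_four_sq : exp (-(I * (Real.pi / 4 : ℂ))) ^ 2 = -I := by
  have h2 : ((√2 : ℝ) : ℂ) ^ 2 = 2 := by
    rw [← ofReal_pow, Real.sq_sqrt (by norm_num)]; norm_num
  rw [exp_neg_I_pi_div_four]
  push_cast
  linear_combination (1 / 4 - I / 2 + I ^ 2 / 4 : ℂ) * h2 + (1 / 2 : ℂ) * I_sq

theorem norm_exp_neg_I_pi_div_four : ‖exp (-(I * (Real.pi / 4 : ℂ)))‖ = 1 := by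
  have : -(I * (Real.pi / 4 : ℂ)) = ((-(Real.pi / 4) : ℝ) : ℂ) * I := by push_cast; ring
  rw [this, norm_exp_ofReal_mul_I]

theorem greenKernel_saddle (c₃ c₄ y ω t : ℝ) :
    greenKernel c₃ c₄ (-(3 * c₃ * y * ω ^ 2)) y (-ω + exp (-(I * (Real.pi / 4 : ℂ))) * t) =
      saddleAmplitude c₃ y ω t *
        exp (-(c₄ * y * (-ω + exp (-(I * (Real.pi / 4 : ℂ))) * t) ^ 4)) := by
  have he := exp_neg_I_pi_div_four_sq
  rw [greenKernel, saddleAmplitude, ← exp_add]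
  congr 1
  set e := exp (-(I * (Real.pi / 4 : ℂ)))
  push_cast
  linear_combination (I * c₃ * y * (-3 * ω * t ^ 2 + e * t ^ 3) : ℂ) * he +
    (3 * c₃ * y * ω * t ^ 2 - c₃ * y * e * t ^ 3 : ℂ) * I_sq

/-- Up to the end `t = √2 ω` of the segment, the cubic term is at most a third of the quadratic term
`3 c₃ y ω t²`. -/
theorem norm_saddleAmplitude_le {c₃ y ω t : ℝ} (hc₃ : 0 < c₃) (hy : 0 < y)
    (ht : t ≤ √2 * ω) : ‖saddleAmplitude c₃ y ω t‖ ≤ Real.exp (-(2 * (c₃ * y * ω)) * t ^ 2) := by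
  have hre : (2 * I * c₃ * y * ω ^ 3 - 3 * c₃ * y * ω * t ^ 2 +
      c₃ * y * exp (-(I * (Real.pi / 4 : ℂ))) * (t : ℂ) ^ 3 : ℂ).re =
      -(3 * c₃ * y * ω * t ^ 2) + c₃ * y * (√2 / 2 * t) * t ^ 2 := by
    rw [exp_neg_I_pi_div_four]
    have : (2 * I * c₃ * y * ω ^ 3 - 3 * c₃ * y * ω * t ^ 2 +
      c₃ * y * (((√2 / 2 : ℝ) : ℂ) - ((√2 / 2 : ℝ) : ℂ) * I) * (t : ℂ) ^ 3 : ℂ) =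
      ((-(3 * c₃ * y * ω * t ^ 2) + c₃ * y * (√2 / 2 * t) * t ^ 2 : ℝ) : ℂ) +
      ((2 * c₃ * y * ω ^ 3 - c₃ * y * (√2 / 2) * t ^ 3 : ℝ) : ℂ) * I := by
      push_cast; ring
    rw [this, add_re, ofReal_re, re_ofReal_mul, I_re, mul_zero, add_zero]
  rw [saddleAmplitude, norm_exp, hre, Real.exp_le_exp]
  have h1 : √2 / 2 * t ≤ ω := by
    have h2 : √2 * √2 = 2 := Real.mul_self_sqrt (by norm_num)
    have h3 := mul_le_mul_of_nonneg_left ht (show 0 ≤ √2 / 2 by positivity)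
    linear_combination h3 + ω / 2 * h2
  have h2 : c₃ * y * (√2 / 2 * t) * t ^ 2 ≤ c₃ * y * ω * t ^ 2 := by gcongr
  linarith

/-- Identifies the profile with the segment integral whose dissipative factor is frozen at the
saddle point; the phase `exp(-iπ/4)` is `dz/dt`. -/
theorem oscProfile_saddle {c₃ c₄ y ω : ℝ} (hc₃ : 0 < c₃) (hy : 0 < y) (hω : 0 < ω) :
    oscProfile c₃ c₄ (-(3 * c₃ * y * ω ^ 2)) y =
      (1 / (2 * Real.pi) : ℂ) * ∫ t in (-(√2 * ω))..(√2 * ω),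
        exp (-(I * (Real.pi / 4 : ℂ))) *
          (saddleAmplitude c₃ y ω t * exp (-(c₄ * y * ω ^ 4))) := by
  have hx : |(-(3 * c₃ * y * ω ^ 2))| = 3 * c₃ * y * ω ^ 2 := by
    rw [abs_neg, abs_of_pos (by positivity)]
  have h1 : c₄ * (-(3 * c₃ * y * ω ^ 2)) ^ 2 / (9 * c₃ ^ 2 * y) = c₄ * y * ω ^ 4 := by
    field_simp
    ring
  have h2 : 2 * (3 * c₃ * y * ω ^ 2) ^ (3 / 2 : ℝ) / (3 * √(3 * c₃ * y)) =
      2 * c₃ * y * ω ^ 3 := by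
    have h3 : (3 * c₃ * y * ω ^ 2) ^ (3 / 2 : ℝ) = 3 * c₃ * y * √(3 * c₃ * y) * ω ^ 3 := by
      have := mul_sq_rpow_div (y := 3 * c₃ * y) (by positivity) hω.le
      rw [div_eq_iff (by positivity)] at this
      rw [this, Real.sqrt_eq_rpow]; ring
    rw [h3]
    field_simp
  have h3 : √(2 * (3 * c₃ * y * ω ^ 2) / (3 * c₃ * y)) = √2 * ω := by
    rw [← Real.sqrt_sq hω.le, ← Real.sqrt_mul (by norm_num), Real.sqrt_sq hω.le]
    congr 1
    field_simp
  have h4 : √(3 * c₃ * (3 * c₃ * y * ω ^ 2) * y) = 3 * c₃ * y * ω := by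
    rw [← Real.sqrt_sq (show 0 ≤ 3 * c₃ * y * ω by positivity)]
    congr 1
    ring
  rw [oscProfile, hx, abs_of_pos hc₃, h1, h2, h3, h4, mul_assoc, mul_assoc,
    ← intervalIntegral.integral_const_mul, ← intervalIntegral.integral_const_mul]
  congr 1
  refine intervalIntegral.integral_congr fun t _ => ?_
  simp only [saddleAmplitude, ofReal_exp, ← exp_add]
  congr 1
  push_cast
  ring

theorem norm_pow_four_sub_le {ω t : ℝ} (hω : 0 < ω) (ht : |t| ≤ √2 * ω) :
    ‖(-(ω : ℂ) + exp (-(I * (Real.pi / 4 : ℂ))) * t) ^ 4 - (ω : ℂ) ^ 4‖ ≤ 24 * ω ^ 3 * |t| := by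
  set s := exp (-(I * (Real.pi / 4 : ℂ))) * (t : ℂ) with hs
  have hns : ‖s‖ = |t| := by
    rw [hs, norm_mul, norm_exp_neg_I_pi_div_four, one_mul, norm_real, Real.norm_eq_abs]
  have hfac : (-(ω : ℂ) + s) ^ 4 - (ω : ℂ) ^ 4 =
      s * (-4 * (ω : ℂ) ^ 3 + 6 * (ω : ℂ) ^ 2 * s - 4 * ω * s ^ 2 + s ^ 3) := by ring
  have hnω : ‖(ω : ℂ)‖ = ω := by rw [norm_real, Real.norm_of_nonneg hω.le]
  have h2 : √2 ≤ 3 / 2 := by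
    rw [Real.sqrt_le_left (by norm_num)]; norm_num
  -- With `|t| ≤ 3ω/2` and `t² ≤ 2ω²` the four terms contribute `4 + 9 + 8 + 3 = 24`.
  have ht' : |t| ≤ 3 / 2 * ω := ht.trans (by gcongr)
  have hsq : |t| ^ 2 ≤ 2 * ω ^ 2 := by
    calc |t| ^ 2 ≤ (√2 * ω) ^ 2 := by gcongr
      _ = 2 * ω ^ 2 := by rw [mul_pow, Real.sq_sqrt (by norm_num)]
  rw [hfac, norm_mul, hns, mul_comm]
  gcongr
  calc ‖-4 * (ω : ℂ) ^ 3 + 6 * (ω : ℂ) ^ 2 * s - 4 * ω * s ^ 2 + s ^ 3‖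
      ≤ ‖-4 * (ω : ℂ) ^ 3‖ + ‖6 * (ω : ℂ) ^ 2 * s‖ + ‖4 * (ω : ℂ) * s ^ 2‖ + ‖s ^ 3‖ :=
        (norm_add_le _ _).trans (by
          gcongr
          exact (norm_sub_le _ _).trans (by gcongr; exact norm_add_le _ _))
    _ = 4 * ω ^ 3 + 6 * ω ^ 2 * |t| + 4 * ω * |t| ^ 2 + |t| ^ 2 * |t| := by
        simp only [norm_mul, norm_neg, norm_pow, hnω, hns, Complex.norm_ofNat]
        ring
    _ ≤ 4 * ω ^ 3 + 6 * ω ^ 2 * (3 / 2 * ω) + 4 * ω * (2 * ω ^ 2) + 2 * ω ^ 2 * (3 / 2 * ω) := by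
        gcongr
    _ = 24 * ω ^ 3 := by ring

/-- The exponent `c₄ y |z⁴ - ω⁴|` is absorbed by the Gaussian and by `c₄ y ω⁴`. -/
theorem dissipation_absorb {c₃ c₄ y ω t : ℝ} (hc₃ : 0 < c₃) (hc₄ : 0 < c₄) (hy : 0 < y)
    (hω : 0 < ω) (hsmall : 288 * c₄ * ω ≤ c₃) :
    c₄ * y * (24 * ω ^ 3 * |t|) ≤ c₃ * y * ω * t ^ 2 + c₄ / 2 * y * ω ^ 4 := by
  have h1 : 24 * c₄ * ω ^ 2 * |t| ≤ c₃ * t ^ 2 + 144 * c₄ ^ 2 * ω ^ 4 / c₃ := by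
    rw [← sq_abs t]
    have h2 : 0 ≤ c₃ * (|t| - 12 * c₄ * ω ^ 2 / c₃) ^ 2 := by positivity
    have h3 : c₃ * (|t| - 12 * c₄ * ω ^ 2 / c₃) ^ 2 =
        c₃ * |t| ^ 2 + 144 * c₄ ^ 2 * ω ^ 4 / c₃ - 24 * c₄ * ω ^ 2 * |t| := by field_simp; ring
    linarith
  -- The threshold `288` in `hsmall` is exactly what makes the remainder of the completed square at
  -- most half of `c₄ ω³`.
  have h2 : 144 * c₄ ^ 2 * ω ^ 4 / c₃ ≤ c₄ / 2 * ω ^ 3 := by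
    rw [div_le_iff₀ hc₃]
    have := mul_le_mul_of_nonneg_left hsmall (show 0 ≤ c₄ / 2 * ω ^ 3 by positivity)
    nlinarith
  have h3 := mul_le_mul_of_nonneg_left (h1.trans (add_le_add_right h2 _))
    (show 0 ≤ y * ω by positivity)
  nlinarith

theorem norm_exp_sub_one_le_norm_mul_exp (w : ℂ) : ‖exp w - 1‖ ≤ ‖w‖ * Real.exp ‖w‖ := by
  simpa using norm_exp_sub_sum_le_norm_mul_exp w 1

/-- Half of the Gaussian absorbs the factor `|t|`, since `u ≤ 1 + u²/2 ≤ exp(u²/2)` with `u = √β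
|t|`. -/
theorem abs_mul_exp_neg_le {β : ℝ} (hβ : 0 < β) (t : ℝ) :
    |t| * Real.exp (-β * t ^ 2) ≤ 1 / √β * Real.exp (-(β / 2) * t ^ 2) := by
  have h1 : √β * |t| ≤ Real.exp (β / 2 * t ^ 2) := by
    have h2 : (√β * |t|) ^ 2 = β * t ^ 2 := by rw [mul_pow, Real.sq_sqrt hβ.le, sq_abs]
    have := Real.add_one_le_exp (β / 2 * t ^ 2)
    nlinarith [sq_nonneg (√β * |t| - 1)]
  have h3 : Real.exp (-(β / 2) * t ^ 2) =
      Real.exp (β / 2 * t ^ 2) * Real.exp (-β * t ^ 2) := by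
    rw [← Real.exp_add]; congr 1; ring
  have hs : 0 < √β := Real.sqrt_pos.mpr hβ
  rw [h3, ← mul_assoc]
  gcongr
  rw [one_div, ← div_eq_inv_mul, le_div_iff₀ hs, mul_comm]
  exact h1

theorem norm_intervalIntegral_le_gaussian {g : ℝ → ℂ} {l A b : ℝ} (hl : 0 ≤ l)
    (hA : 0 ≤ A) (hb : 0 < b) (h : ∀ t, |t| ≤ l → ‖g t‖ ≤ A * Real.exp (-b * t ^ 2)) :
    ‖∫ t in (-l)..l, g t‖ ≤ A * √(Real.pi / b) := by
  rw [intervalIntegral.integral_of_le (by linarith)]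
  exact norm_setIntegral_le_gaussian measurableSet_Ioc hA hb fun t ht =>
    h t (abs_le.mpr ⟨ht.1.le, ht.2⟩)

theorem norm_greenKernel_saddle_sub_le {c₃ c₄ y ω t : ℝ} (hc₃ : 0 < c₃) (hc₄ : 0 < c₄)
    (hy : 0 < y) (hω : 0 < ω) (hsmall : 288 * c₄ * ω ≤ c₃) (ht : |t| ≤ √2 * ω) :
    ‖greenKernel c₃ c₄ (-(3 * c₃ * y * ω ^ 2)) y (-ω + exp (-(I * (Real.pi / 4 : ℂ))) * t) -
      saddleAmplitude c₃ y ω t * exp (-(c₄ * y * ω ^ 4))‖ ≤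
      24 * c₄ * y * ω ^ 3 / √(c₃ * y * ω) * Real.exp (-(c₄ / 2 * y * ω ^ 4)) *
        Real.exp (-(c₃ * y * ω / 2) * t ^ 2) := by
  rw [greenKernel_saddle, ← mul_sub, norm_mul]
  set z := -(ω : ℂ) + exp (-(I * (Real.pi / 4 : ℂ))) * t with hz
  set w := -(c₄ * y * (z ^ 4 - (ω : ℂ) ^ 4) : ℂ) with hw
  have hwn : ‖w‖ ≤ c₄ * y * (24 * ω ^ 3 * |t|) := by
    rw [hw, norm_neg, norm_mul, norm_mul, norm_real, norm_real, Real.norm_of_nonneg hc₄.le,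
      Real.norm_of_nonneg hy.le]
    gcongr
    exact norm_pow_four_sub_le hω ht
  have h1 : exp (-(c₄ * y * z ^ 4)) - exp (-(c₄ * y * ω ^ 4 : ℂ)) =
      ((Real.exp (-(c₄ * y * ω ^ 4)) : ℝ) : ℂ) * (exp w - 1) := by
    rw [mul_sub, ofReal_exp, ← exp_add, hw]
    push_cast
    ring_nf
  have h2 := dissipation_absorb (t := t) hc₃ hc₄ hy hω hsmall
  have hβ : 0 < c₃ * y * ω := by positivity
  rw [h1, norm_mul, norm_real, Real.norm_of_nonneg (Real.exp_pos _).le]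
  calc ‖saddleAmplitude c₃ y ω t‖ * (Real.exp (-(c₄ * y * ω ^ 4)) * ‖exp w - 1‖)
      ≤ Real.exp (-(2 * (c₃ * y * ω)) * t ^ 2) * (Real.exp (-(c₄ * y * ω ^ 4)) *
          (c₄ * y * (24 * ω ^ 3 * |t|) *
            Real.exp (c₃ * y * ω * t ^ 2 + c₄ / 2 * y * ω ^ 4))) := by
        gcongr
        · exact norm_saddleAmplitude_le hc₃ hy ((le_abs_self t).trans ht)
        · refine (norm_exp_sub_one_le_norm_mul_exp w).trans ?_
          gcongr
          exact hwn.trans h2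
    _ = 24 * c₄ * y * ω ^ 3 * Real.exp (-(c₄ / 2 * y * ω ^ 4)) *
          (|t| * Real.exp (-(c₃ * y * ω) * t ^ 2)) := by
        have : Real.exp (-(2 * (c₃ * y * ω)) * t ^ 2) * Real.exp (-(c₄ * y * ω ^ 4)) *
            Real.exp (c₃ * y * ω * t ^ 2 + c₄ / 2 * y * ω ^ 4) =
            Real.exp (-(c₄ / 2 * y * ω ^ 4)) * Real.exp (-(c₃ * y * ω) * t ^ 2) := by
          rw [← Real.exp_add, ← Real.exp_add, ← Real.exp_add]
          congr 1; ring
        linear_combination (24 * c₄ * y * ω ^ 3 * |t|) * this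
    _ ≤ 24 * c₄ * y * ω ^ 3 * Real.exp (-(c₄ / 2 * y * ω ^ 4)) *
          (1 / √(c₃ * y * ω) * Real.exp (-(c₃ * y * ω / 2) * t ^ 2)) := by
        exact mul_le_mul_of_nonneg_left (abs_mul_exp_neg_le hβ t) (by positivity)
    _ = _ := by ring

theorem norm_greenKernel_saddle_le {c₃ c₄ y ω t : ℝ} (hc₃ : 0 < c₃) (hc₄ : 0 < c₄)
    (hy : 0 < y) (hω : 0 < ω) (hsmall : 288 * c₄ * ω ≤ c₃) (ht : |t| ≤ √2 * ω) :
    ‖greenKernel c₃ c₄ (-(3 * c₃ * y * ω ^ 2)) y (-ω + exp (-(I * (Real.pi / 4 : ℂ))) * t)‖ ≤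
      Real.exp (-(c₃ * y * ω) * t ^ 2) := by
  rw [greenKernel_saddle, norm_mul]
  set z := -(ω : ℂ) + exp (-(I * (Real.pi / 4 : ℂ))) * t with hz
  have h2 := dissipation_absorb (t := t) hc₃ hc₄ hy hω hsmall
  have h3 : ‖exp (-(c₄ * y * z ^ 4))‖ ≤ Real.exp (c₃ * y * ω * t ^ 2) := by
    rw [norm_exp, Real.exp_le_exp]
    have h4 : -(c₄ * y * z ^ 4 : ℂ) =
        ((c₄ * y : ℝ) : ℂ) * (-(z ^ 4 - (ω : ℂ) ^ 4)) + ((-(c₄ * y * ω ^ 4) : ℝ) : ℂ) := by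
      push_cast; ring
    rw [h4, add_re, re_ofReal_mul, ofReal_re]
    have h5 : (-(z ^ 4 - (ω : ℂ) ^ 4)).re ≤ 24 * ω ^ 3 * |t| :=
      (re_le_norm _).trans (by rw [norm_neg]; exact norm_pow_four_sub_le hω ht)
    have h6 : c₄ * y * (-(z ^ 4 - (ω : ℂ) ^ 4)).re ≤ c₄ * y * (24 * ω ^ 3 * |t|) := by gcongr
    have h7 : 0 ≤ c₄ * y * ω ^ 4 := by positivity
    linarith
  calc _ ≤ Real.exp (-(2 * (c₃ * y * ω)) * t ^ 2) * Real.exp (c₃ * y * ω * t ^ 2) :=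
        mul_le_mul (norm_saddleAmplitude_le hc₃ hy ((le_abs_self t).trans ht)) h3
          (norm_nonneg _) (Real.exp_pos _).le
    _ = _ := by rw [← Real.exp_add]; congr 1; ring

/-- The growth `4 c₃ y ω³` at height `ω` is beaten by `3 c₃ y ω θ²`, because `θ² ≥ 4 ω²` on the
tail. -/
theorem norm_greenKernel_tail_le {c₃ c₄ y ω θ : ℝ} (hc₃ : 0 < c₃) (hc₄ : 0 < c₄)
    (hy : 0 < y) (hω : 0 < ω) (hsmall : 288 * c₄ * ω ≤ c₃) (hθ : θ ≤ -(2 * ω)) :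
    ‖greenKernel c₃ c₄ (-(3 * c₃ * y * ω ^ 2)) y (θ + ω * I)‖ ≤
      Real.exp (-(2 * c₃ * y * ω ^ 3)) * Real.exp (-(c₃ * y * ω / 2) * θ ^ 2) := by
  rw [norm_greenKernel, ← Real.exp_add, Real.exp_le_exp, greenExponent]
  have h1 : 4 * ω ^ 2 ≤ θ ^ 2 := by nlinarith
  have h2 : c₃ * y * ω * (4 * ω ^ 2) ≤ c₃ * y * ω * θ ^ 2 := by gcongr
  have h3 : y * ω * θ ^ 2 * (288 * c₄ * ω) ≤ y * ω * θ ^ 2 * c₃ := by gcongr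
  have h4 : 0 ≤ c₄ * y * (θ ^ 4 + ω ^ 4) := by positivity
  have h5 : 0 ≤ c₄ * y * θ ^ 2 * ω ^ 2 := by positivity
  nlinarith

theorem approxGreen_saddle_contour {c₃ c₄ y ω : ℝ} (hc₃ : 0 < c₃) (hc₄ : 0 < c₄) (hy : 0 < y)
    (hω : 0 < ω) (x : ℝ) :
    approxGreen c₃ c₄ x y = ((1 / Real.pi *
      ((∫ θ : ℝ in Iic (-(2 * ω)), greenKernel c₃ c₄ x y (θ + ω * I)) +
        ∫ t in (-(√2 * ω))..(√2 * ω), exp (-(I * (Real.pi / 4 : ℂ))) *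
          greenKernel c₃ c₄ x y (-ω + exp (-(I * (Real.pi / 4 : ℂ))) * t)).re : ℝ) : ℂ) := by
  obtain ⟨A, hA⟩ := exists_norm_greenKernel_le hc₃ hc₄ hy x ω
  rw [approxGreen_eq_re_integral hc₃ hc₄ hy x (-ω), integral_left_contour (A := A) hω one_pos
    (differentiable_greenKernel c₃ c₄ x y).differentiableOn]
  intro θ _ η hη
  rw [uIcc_of_le (by linarith)] at hη
  exact hA θ η (abs_le.mpr hη)

theorem continuous_saddleAmplitude (c₃ y ω : ℝ) : Continuous (saddleAmplitude c₃ y ω) := by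
  unfold saddleAmplitude; fun_prop

/-- Comparison with the oscillating profile, in terms of the saddle point `ω`. -/
theorem norm_approxGreen_sub_oscProfile_le {c₃ c₄ y ω : ℝ} (hc₃ : 0 < c₃) (hc₄ : 0 < c₄)
    (hy : 0 < y) (hω : 0 < ω) (hsmall : 288 * c₄ * ω ≤ c₃) :
    ‖approxGreen c₃ c₄ (-(3 * c₃ * y * ω ^ 2)) y -
        ((2 * (oscProfile c₃ c₄ (-(3 * c₃ * y * ω ^ 2)) y).re : ℝ) : ℂ)‖ ≤
      2 / √(c₃ * y * ω / 2) * Real.exp (-(2 * c₃ * y * ω ^ 3)) +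
      72 * c₄ / c₃ * ω ^ 2 * Real.exp (-(c₄ / 2 * y * ω ^ 4)) := by
  set e := exp (-(I * (Real.pi / 4 : ℂ))) with he
  set x := -(3 * c₃ * y * ω ^ 2) with hx
  set T := ∫ θ : ℝ in Iic (-(2 * ω)), greenKernel c₃ c₄ x y (θ + ω * I) with hT
  set S := ∫ t in (-(√2 * ω))..(√2 * ω), e * greenKernel c₃ c₄ x y (-ω + e * t) with hS
  set S' := ∫ t in (-(√2 * ω))..(√2 * ω),
    e * (saddleAmplitude c₃ y ω t * exp (-(c₄ * y * ω ^ 4))) with hS'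
  have hβ : 0 < c₃ * y * ω / 2 := by positivity
  have hTn : ‖T‖ ≤ Real.exp (-(2 * c₃ * y * ω ^ 3)) * (2 / √(c₃ * y * ω / 2)) := by
    refine (norm_setIntegral_le_gaussian measurableSet_Iic (Real.exp_pos _).le hβ fun θ hθ =>
      norm_greenKernel_tail_le hc₃ hc₄ hy hω hsmall hθ).trans ?_
    gcongr
    exact sqrt_pi_div_le
  have hSn : ‖S - S'‖ ≤ 72 * c₄ / c₃ * ω ^ 2 * Real.exp (-(c₄ / 2 * y * ω ^ 4)) := by
    have hsub : S - S' = ∫ t in (-(√2 * ω))..(√2 * ω), (e * greenKernel c₃ c₄ x y (-ω + e * t) -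
        e * (saddleAmplitude c₃ y ω t * exp (-(c₄ * y * ω ^ 4)))) := by
      rw [hS, hS', intervalIntegral.integral_sub]
      · have := continuous_greenKernel c₃ c₄ x y
        exact Continuous.intervalIntegrable (by fun_prop) _ _
      · have := continuous_saddleAmplitude c₃ y ω
        exact Continuous.intervalIntegrable (by fun_prop) _ _
    rw [hsub]
    refine (norm_intervalIntegral_le_gaussian (A := 24 * c₄ * y * ω ^ 3 / √(c₃ * y * ω) *
      Real.exp (-(c₄ / 2 * y * ω ^ 4))) (by positivity) (by positivity) hβ fun t ht => ?_).trans ?_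
    · rw [← mul_sub, norm_mul, he, norm_exp_neg_I_pi_div_four, one_mul]
      exact norm_greenKernel_saddle_sub_le hc₃ hc₄ hy hω hsmall ht
    · have h1 : √(Real.pi / (c₃ * y * ω / 2)) ≤ 3 / √(c₃ * y * ω) := by
        rw [← Real.sqrt_sq (show (0 : ℝ) ≤ 3 by norm_num), ← Real.sqrt_div (by norm_num),
          div_div_eq_mul_div]
        apply Real.sqrt_le_sqrt
        gcongr
        linarith [Real.pi_le_four]
      calc 24 * c₄ * y * ω ^ 3 / √(c₃ * y * ω) * Real.exp (-(c₄ / 2 * y * ω ^ 4)) *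
            √(Real.pi / (c₃ * y * ω / 2))
          ≤ 24 * c₄ * y * ω ^ 3 / √(c₃ * y * ω) * Real.exp (-(c₄ / 2 * y * ω ^ 4)) *
            (3 / √(c₃ * y * ω)) := by gcongr
        _ = 72 * c₄ * y * ω ^ 3 / (√(c₃ * y * ω) * √(c₃ * y * ω)) *
              Real.exp (-(c₄ / 2 * y * ω ^ 4)) := by field_simp; norm_num
        _ = _ := by
            rw [Real.mul_self_sqrt (by positivity)]
            field_simp
  have hg : 2 * (oscProfile c₃ c₄ x y).re = 1 / Real.pi * S'.re := by
    have h : oscProfile c₃ c₄ x y = ((1 / (2 * Real.pi) : ℝ) : ℂ) * S' := by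
      rw [hx, oscProfile_saddle hc₃ hy hω]; push_cast; rfl
    rw [h, re_ofReal_mul]
    field_simp
  have hG := approxGreen_saddle_contour hc₃ hc₄ hy hω x
  rw [← he, ← hT, ← hS] at hG
  rw [hG, hg, ← ofReal_sub, norm_real, ← mul_sub, ← sub_re, norm_mul,
    Real.norm_of_nonneg (by positivity)]
  have hpi : 1 / Real.pi ≤ 1 := by
    rw [div_le_one Real.pi_pos]; linarith [Real.pi_gt_three]
  calc 1 / Real.pi * ‖(T + S - S').re‖ ≤ 1 * (‖T‖ + ‖S - S'‖) := by
        gcongr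
        refine (abs_re_le_norm _).trans ?_
        rw [add_sub_assoc]
        exact norm_add_le _ _
    _ ≤ _ := by rw [one_mul, mul_comm (2 / _)]; gcongr

/-! ### The cumulative function -/

theorem greenKernel_eq_exp_mul (c₃ c₄ x y : ℝ) (z : ℂ) :
    greenKernel c₃ c₄ x y z = exp (I * z * x) * greenKernel c₃ c₄ 0 y z := by
  rw [greenKernel, greenKernel, ← exp_add]
  congr 1
  push_cast
  ring

/-- Integration of the Green's function in `x` divides the kernel by `i z` on a line below the real
axis. -/
theorem integral_Iic_approxGreen {c₃ c₄ y δ : ℝ} (hc₃ : 0 < c₃) (hc₄ : 0 < c₄) (hy : 0 < y)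
    (hδ : 0 < δ) (x : ℝ) :
    IntegrableOn (fun ξ : ℝ => approxGreen c₃ c₄ ξ y) (Iic x) ∧
    ∫ ξ in Iic x, approxGreen c₃ c₄ ξ y = ((1 / Real.pi * (∫ θ : ℝ in Iic 0,
      greenKernel c₃ c₄ x y (θ + (-δ : ℝ) * I) / (I * (θ + (-δ : ℝ) * I))).re : ℝ) : ℂ) := by
  set H : ℝ → ℝ → ℂ := fun ξ θ => greenKernel c₃ c₄ ξ y (θ + (-δ : ℝ) * I) with hH
  have hHfun : ∀ ξ θ : ℝ, H ξ θ = exp (I * (θ + (-δ : ℝ) * I) * ξ) *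
      greenKernel c₃ c₄ 0 y (θ + (-δ : ℝ) * I) := fun ξ θ => greenKernel_eq_exp_mul _ _ _ _ _
  have hre : ∀ θ : ℝ, (I * (θ + (-δ : ℝ) * I)).re = δ := by
    intro θ
    simp
  have hint : Integrable (Function.uncurry H)
      ((volume.restrict (Iic x)).prod (volume.restrict (Iic 0))) := by
    -- At height `-δ` the factor `exp(i z ξ)` has modulus `exp(δ ξ)`, which is integrable at `-∞`
    -- and permits Fubini.
    have h1 : Integrable (fun ξ : ℝ => Real.exp (δ * ξ)) (volume.restrict (Iic x)) :=
      integrableOn_exp_mul_Iic hδ x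
    have h2 : Integrable (fun θ : ℝ => ‖greenKernel c₃ c₄ 0 y (θ + (-δ : ℝ) * I)‖)
        (volume.restrict (Iic 0)) := (integrable_greenKernel hc₃ hc₄ hy 0 (-δ)).norm.restrict
    refine (h1.mul_prod h2).mono' ?_ (Eventually.of_forall fun p => ?_)
    · refine Continuous.aestronglyMeasurable ?_
      have := continuous_greenKernel c₃ c₄ 0 y
      simp only [Function.uncurry_def, hHfun]
      fun_prop
    · change ‖H p.1 p.2‖ ≤ _
      rw [hHfun, norm_mul, norm_exp, re_mul_ofReal, hre]
  have hG : ∀ ξ : ℝ, approxGreen c₃ c₄ ξ y =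
      ((1 / Real.pi * (∫ θ : ℝ in Iic 0, H ξ θ).re : ℝ) : ℂ) :=
    fun ξ => approxGreen_eq_re_integral hc₃ hc₄ hy ξ (-δ)
  have hleft := hint.integral_prod_left
  simp only [Function.uncurry_apply_pair] at hleft
  refine ⟨?_, ?_⟩
  · simp only [hG]
    exact (hleft.re.const_mul (1 / Real.pi)).ofReal
  · simp only [hG]
    rw [integral_complex_ofReal, integral_const_mul]
    have := integral_re hleft
    simp only [RCLike.re_eq_complex_re] at this
    rw [this, integral_integral_swap hint]
    congr 4
    ext θ
    simp only [hHfun]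
    rw [integral_mul_const, integral_exp_mul_complex_Iic (by rw [hre]; exact hδ),
      greenKernel_eq_exp_mul c₃ c₄ x]
    ring

theorem continuous_approxGreen {c₃ c₄ y : ℝ} (hc₃ : 0 < c₃) (hc₄ : 0 < c₄) (hy : 0 < y) :
    Continuous (fun x : ℝ => approxGreen c₃ c₄ x y) := by
  simp only [approxGreen_eq_integral_greenKernel]
  refine continuous_const.mul (continuous_of_dominated
    (bound := fun θ : ℝ => ‖greenKernel c₃ c₄ 0 y θ‖) (fun x => ?_)
    (fun x => Eventually.of_forall fun θ => ?_) ?_ (Eventually.of_forall fun θ => ?_))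
  · exact ((continuous_greenKernel c₃ c₄ x y).comp continuous_ofReal).aestronglyMeasurable
  · rw [greenKernel_eq_exp_mul, norm_mul, norm_exp]
    simp
  · simpa using (integrable_greenKernel hc₃ hc₄ hy 0 0).norm
  · unfold greenKernel
    fun_prop

/-- Pointwise decay in the range `|ξ| ≥ |x| ≥ c̄ y`, with the decay rate at `x` factored out. -/
theorem exists_norm_approxGreen_le_exp_mul_exp {c₃ c₄ cbar ymin : ℝ} (hc₃ : 0 < c₃) (hc₄ : 0 < c₄)
    (hcbar : 0 < cbar) (hymin : 0 < ymin) : ∃ C > 0, ∃ c > 0, ∃ β > 0, ∀ x ξ y : ℝ, ymin ≤ y →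
      cbar * y ≤ |x| → |x| ≤ |ξ| → ‖approxGreen c₃ c₄ ξ y‖ ≤
        C * Real.exp (-(c * (|x| ^ (4 / 3 : ℝ) / y ^ (1 / 3 : ℝ)))) * Real.exp (-(β * |ξ|)) := by
  obtain ⟨C, hC, c, hc, h⟩ := exists_norm_approxGreen_le_outer hc₃ hc₄ hcbar
  obtain ⟨r₀, hr₀, hcr⟩ := exists_pos_cube_eq hcbar
  refine ⟨C / ymin ^ (1 / 4 : ℝ), by positivity, c / 2, by positivity, c / 2 * r₀, by positivity,
    fun x ξ y hy hx hξ => ?_⟩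
  have hy' : 0 < y := hymin.trans_le hy
  refine (h ξ y hy' (hx.trans hξ)).trans ?_
  rw [mul_assoc, ← Real.exp_add]
  -- Half of the exponent is compared with its value at `x`, the other half with the linear function
  -- `r₀ |ξ|`.
  have h1 : |x| ^ (4 / 3 : ℝ) / y ^ (1 / 3 : ℝ) ≤ |ξ| ^ (4 / 3 : ℝ) / y ^ (1 / 3 : ℝ) := by gcongr
  have h2 := mul_abs_le_rpow_div (ξ := ξ) hr₀.le hy' (by rw [← hcr]; exact hx.trans hξ)
  gcongr
  have h3 := mul_le_mul_of_nonneg_left h1 hc.le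
  have h4 := mul_le_mul_of_nonneg_left h2 hc.le
  linarith

theorem exists_norm_integral_approxGreen_le_outer {c₃ c₄ cbar ymin : ℝ} (hc₃ : 0 < c₃)
    (hc₄ : 0 < c₄) (hcbar : 0 < cbar) (hymin : 0 < ymin) : ∃ C > 0, ∃ c > 0,
      ∀ x y : ℝ, ymin ≤ y →
        (x ≤ -(cbar * y) → ‖∫ ξ in Iic x, approxGreen c₃ c₄ ξ y‖ ≤
          C * Real.exp (-(c * (|x| ^ (4 / 3 : ℝ) / y ^ (1 / 3 : ℝ))))) ∧
        (cbar * y ≤ x → IntegrableOn (fun ξ : ℝ => approxGreen c₃ c₄ ξ y) (Ioi x) ∧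
          ‖∫ ξ in Ioi x, approxGreen c₃ c₄ ξ y‖ ≤
            C * Real.exp (-(c * (|x| ^ (4 / 3 : ℝ) / y ^ (1 / 3 : ℝ))))) := by
  obtain ⟨C, hC, c, hc, β, hβ, h⟩ := exists_norm_approxGreen_le_exp_mul_exp hc₃ hc₄ hcbar hymin
  refine ⟨C / β, by positivity, c, hc, fun x y hy => ⟨fun hx => ?_, fun hx => ?_⟩⟩
  · have hy' : 0 < y := hymin.trans_le hy
    have hxneg : x < 0 := by nlinarith
    have hint := (integrableOn_exp_mul_Iic hβ x).const_mul
      (C * Real.exp (-(c * (|x| ^ (4 / 3 : ℝ) / y ^ (1 / 3 : ℝ)))))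
    refine (norm_integral_le_of_norm_le hint
      ((ae_restrict_mem measurableSet_Iic).mono fun ξ (hξ : ξ ≤ x) => ?_)).trans ?_
    · have h1 := h x ξ y hy (by rw [abs_of_neg hxneg]; linarith)
        (by rw [abs_of_neg hxneg, abs_of_neg (hξ.trans_lt hxneg)]; linarith)
      rwa [abs_of_neg (hξ.trans_lt hxneg), mul_neg, neg_neg] at h1
    · rw [integral_const_mul, integral_exp_mul_Iic hβ, mul_div_assoc', div_mul_eq_mul_div]
      refine div_le_div_of_nonneg_right (mul_le_of_le_one_right (by positivity)
        (Real.exp_le_one_iff.mpr ?_)) hβ.le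
      nlinarith
  · have hy' : 0 < y := hymin.trans_le hy
    have hxpos : 0 < x := lt_of_lt_of_le (by positivity) hx
    have hint := (integrableOn_exp_mul_Ioi (neg_neg_of_pos hβ) x).const_mul
      (C * Real.exp (-(c * (|x| ^ (4 / 3 : ℝ) / y ^ (1 / 3 : ℝ)))))
    have hbound : ∀ᵐ ξ ∂(volume.restrict (Ioi x)), ‖approxGreen c₃ c₄ ξ y‖ ≤
        C * Real.exp (-(c * (|x| ^ (4 / 3 : ℝ) / y ^ (1 / 3 : ℝ)))) * Real.exp (-β * ξ) := by
      refine (ae_restrict_mem measurableSet_Ioi).mono fun ξ (hξ : x < ξ) => ?_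
      have h1 := h x ξ y hy (by rwa [abs_of_pos hxpos])
        (by rw [abs_of_pos hxpos, abs_of_pos (hxpos.trans hξ)]; exact hξ.le)
      rwa [abs_of_pos (hxpos.trans hξ), ← neg_mul β] at h1
    refine ⟨hint.mono' (continuous_approxGreen hc₃ hc₄ hy').aestronglyMeasurable hbound,
      (norm_integral_le_of_norm_le hint hbound).trans ?_⟩
    rw [integral_const_mul, integral_exp_mul_Ioi (neg_neg_of_pos hβ), neg_div_neg_eq,
      mul_div_assoc', div_mul_eq_mul_div]
    refine div_le_div_of_nonneg_right (mul_le_of_le_one_right (by positivity)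
      (Real.exp_le_one_iff.mpr ?_)) hβ.le
    nlinarith

theorem integrable_approxGreen {c₃ c₄ y : ℝ} (hc₃ : 0 < c₃) (hc₄ : 0 < c₄) (hy : 0 < y) :
    Integrable (fun x : ℝ => approxGreen c₃ c₄ x y) := by
  -- For fixed `y` the line is cut at `x = y`: Fubini handles the left part, pointwise decay the
  -- right one.
  obtain ⟨C, -, c, -, h⟩ := exists_norm_integral_approxGreen_le_outer hc₃ hc₄ one_pos hy
  rw [← integrableOn_univ, ← Iic_union_Ioi (a := 1 * y)]
  exact (integral_Iic_approxGreen hc₃ hc₄ hy one_pos _).1.union ((h (1 * y) y le_rfl).2 le_rfl).1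

/-- The Green's function has total mass one. -/
theorem integral_approxGreen {c₃ c₄ y : ℝ} (hc₃ : 0 < c₃) (hc₄ : 0 < c₄) (hy : 0 < y) :
    ∫ x : ℝ, approxGreen c₃ c₄ x y = 1 := by
  set h : ℝ → ℂ := fun θ => greenKernel c₃ c₄ 0 y θ with hh
  -- `G` is a rescaled Fourier transform of the kernel at `x = 0`; inversion at `0` returns the
  -- value `h 0 = 1`.
  have hF : ∀ ξ : ℝ, 𝓕 h ξ = (2 * Real.pi : ℂ) * approxGreen c₃ c₄ (-(2 * Real.pi) * ξ) y := by
    intro ξ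
    rw [Real.fourier_real_eq_integral_exp_smul, approxGreen_eq_integral_greenKernel]
    have : (2 * Real.pi : ℂ) ≠ 0 := by exact_mod_cast Real.two_pi_pos.ne'
    rw [← mul_assoc, mul_one_div_cancel this, one_mul]
    congr 1
    ext θ
    rw [greenKernel_eq_exp_mul c₃ c₄ (-(2 * Real.pi) * ξ), smul_eq_mul, hh]
    congr 2
    push_cast
    ring
  have hpi : -(2 * Real.pi) ≠ 0 := by have := Real.pi_pos; linarith
  have hFint : Integrable (𝓕 h) := by
    rw [funext hF]
    exact ((integrable_approxGreen hc₃ hc₄ hy).comp_mul_left' hpi).const_mul _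
  have hcont : Continuous h := (continuous_greenKernel c₃ c₄ 0 y).comp continuous_ofReal
  have hint : Integrable h := by simpa using integrable_greenKernel hc₃ hc₄ hy 0 0
  have hinv := congrFun (hcont.fourierInv_fourier_eq hint hFint) 0
  rw [Real.fourierInv_eq'] at hinv
  have h0 : h 0 = 1 := by simp [hh, greenKernel]
  rw [h0] at hinv
  simp only [inner_zero_right, mul_zero, ofReal_zero, zero_mul, exp_zero, one_smul] at hinv
  rw [funext hF, integral_const_mul,
    Measure.integral_comp_mul_left (fun x => approxGreen c₃ c₄ x y)] at hinv
  rw [← hinv, abs_inv, abs_neg, abs_of_pos Real.two_pi_pos, real_smul, ← mul_assoc]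
  have : (2 * Real.pi : ℂ) ≠ 0 := by exact_mod_cast Real.two_pi_pos.ne'
  push_cast
  rw [mul_inv_cancel₀ this, one_mul]

/-- In the oscillating range the cumulative function is bounded in terms of the saddle point. -/
theorem norm_integral_approxGreen_saddle_le {c₃ c₄ y ω : ℝ} (hc₃ : 0 < c₃) (hc₄ : 0 < c₄)
    (hy : 0 < y) (hω : 0 < ω) (hsmall : 288 * c₄ * ω ≤ c₃) :
    ‖∫ ξ in Iic (-(3 * c₃ * y * ω ^ 2)), approxGreen c₃ c₄ ξ y‖ ≤
      5 / (ω * √(c₃ * y * ω / 2)) := by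
  rw [(integral_Iic_approxGreen hc₃ hc₄ hy hω _).2]
  set x := -(3 * c₃ * y * ω ^ 2) with hx
  set k : ℂ → ℂ := fun z => greenKernel c₃ c₄ x y z / (I * z) with hk
  set e := exp (-(I * (Real.pi / 4 : ℂ))) with he
  obtain ⟨A, hA⟩ := exists_norm_greenKernel_le hc₃ hc₄ hy x ω
  have hnk : ∀ z : ℂ, ‖k z‖ = ‖greenKernel c₃ c₄ x y z‖ / ‖z‖ := by
    intro z; rw [hk, norm_div, norm_mul, norm_I, one_mul]
  have hfar : ∀ θ η : ℝ, θ ≤ -(2 * ω) → 2 * ω ≤ ‖(θ : ℂ) + η * I‖ := by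
    intro θ η hθ
    have := abs_re_le_norm ((θ : ℂ) + η * I)
    rw [add_re, ofReal_re, re_ofReal_mul, I_re, mul_zero, add_zero] at this
    linarith [neg_le_abs θ]
  have hkdiff : DifferentiableOn ℂ k {z | z.re + z.im < 0} := by
    refine (differentiable_greenKernel c₃ c₄ x y).differentiableOn.div (by fun_prop) ?_
    intro z hz h0
    rcases mul_eq_zero.mp h0 with h | h
    · exact I_ne_zero h
    · rw [h] at hz; simp at hz
  have hcontour := integral_left_contour (k := k) (A := A / (2 * ω)) hω one_pos hkdiff
    (fun θ hθ η hη => by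
      rw [uIcc_of_le (by linarith)] at hη
      rw [hnk, div_mul_eq_mul_div]
      exact div_le_div₀ ((norm_nonneg _).trans (hA θ η (abs_le.mpr hη)))
        (hA θ η (abs_le.mpr hη)) (by positivity) (hfar θ η hθ))
  have hβ : 0 < c₃ * y * ω / 2 := by positivity
  have hT : ‖∫ θ : ℝ in Iic (-(2 * ω)), k (θ + ω * I)‖ ≤
      1 / (2 * ω) * (2 / √(c₃ * y * ω / 2)) := by
    refine (norm_setIntegral_le_gaussian measurableSet_Iic (A := 1 / (2 * ω)) (by positivity) hβ
      fun θ hθ => ?_).trans ?_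
    · rw [hnk, div_mul_eq_mul_div, one_mul]
      refine div_le_div₀ (Real.exp_pos _).le ?_ (by positivity) (hfar θ ω hθ)
      refine (norm_greenKernel_tail_le hc₃ hc₄ hy hω hsmall hθ).trans ?_
      refine mul_le_of_le_one_left (Real.exp_pos _).le (Real.exp_le_one_iff.mpr ?_)
      have : 0 ≤ 2 * c₃ * y * ω ^ 3 := by positivity
      linarith
    · gcongr
      exact sqrt_pi_div_le
  have hS : ‖∫ t in (-(√2 * ω))..(√2 * ω), e * k (-ω + e * t)‖ ≤
      2 / ω * (2 / √(c₃ * y * ω / 2)) := by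
    refine (norm_intervalIntegral_le_gaussian (A := 2 / ω) (by positivity) (by positivity) hβ
      fun t ht => ?_).trans ?_
    · have hz : ω / 2 ≤ ‖-(ω : ℂ) + e * t‖ := by
        have h1 : (-(ω : ℂ) + e * t).re + (-(ω : ℂ) + e * t).im = -ω := by
          rw [he, exp_neg_I_pi_div_four]
          simp
        have h2 := neg_le_of_abs_le (abs_re_le_norm (-(ω : ℂ) + e * t))
        have h3 := neg_le_of_abs_le (abs_im_le_norm (-(ω : ℂ) + e * t))
        linarith
      rw [norm_mul, he, norm_exp_neg_I_pi_div_four, one_mul, ← he, hnk]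
      calc ‖greenKernel c₃ c₄ x y (-ω + e * t)‖ / ‖-(ω : ℂ) + e * t‖
          ≤ Real.exp (-(c₃ * y * ω) * t ^ 2) / (ω / 2) :=
            div_le_div₀ (Real.exp_pos _).le
              (norm_greenKernel_saddle_le hc₃ hc₄ hy hω hsmall ht) (by positivity) hz
        _ ≤ Real.exp (-(c₃ * y * ω / 2) * t ^ 2) / (ω / 2) := by
            gcongr
            have : 0 < c₃ * y * ω := by positivity
            linarith
        _ = 2 / ω * Real.exp (-(c₃ * y * ω / 2) * t ^ 2) := by field_simp
    · gcongr
      exact sqrt_pi_div_le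
  rw [hcontour, norm_real, norm_mul, Real.norm_of_nonneg (by positivity)]
  have hpi : 1 / Real.pi ≤ 1 := by
    rw [div_le_one Real.pi_pos]; linarith [Real.pi_gt_three]
  have hs : 0 < √(c₃ * y * ω / 2) := Real.sqrt_pos.mpr hβ
  refine (mul_le_mul hpi ((abs_re_le_norm _).trans ((norm_add_le _ _).trans (add_le_add hT hS)))
    (abs_nonneg _) zero_le_one).trans_eq ?_
  field_simp
  norm_num

/-- The condition `|x| ≥ q` reads `3 c₃ (q ω)² ≥ 1`. This lower bound on `q ω` turns bounds in `y ω`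
into bounds in `q = y^(1/3)`. -/
theorem exists_saddle_point {c₃ ω₀ q x : ℝ} (hc₃ : 0 < c₃) (hω₀ : 0 < ω₀) (hq : 0 < q)
    (hx : -(3 * c₃ * ω₀ ^ 2 * q ^ 3) ≤ x) (hxq : x ≤ -q) :
    ∃ ω, 0 < ω ∧ ω ≤ ω₀ ∧ 1 / √(3 * c₃) ≤ q * ω ∧ x = -(3 * c₃ * q ^ 3 * ω ^ 2) := by
  obtain ⟨ω, hω, hxω⟩ := exists_eq_mul_sq (X := -x) (y := 3 * c₃ * q ^ 3) (by linarith)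
    (by positivity)
  have hlow : 1 / √(3 * c₃) ≤ q * ω := by
    rw [one_div, ← Real.sqrt_inv, Real.sqrt_le_left (by positivity), inv_le_iff_one_le_mul₀
      (by positivity)]
    have : q * 1 ≤ q * ((q * ω) ^ 2 * (3 * c₃)) := by nlinarith
    exact le_of_mul_le_mul_left this hq
  have hpos : 0 < q * ω := lt_of_lt_of_le (by positivity) hlow
  refine ⟨ω, pos_of_mul_pos_right hpos hq.le, ?_, hlow, by linarith⟩
  have : 3 * c₃ * q ^ 3 * ω ^ 2 ≤ 3 * c₃ * q ^ 3 * ω₀ ^ 2 := by linarith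
  exact (pow_le_pow_iff_left₀ hω hω₀.le two_ne_zero).mp
    (le_of_mul_le_mul_left this (by positivity))

/-- The cumulative function is bounded for `x ≤ c̄ y`. -/
theorem exists_norm_integral_approxGreen_le {c₃ c₄ cbar q₀ : ℝ} (hc₃ : 0 < c₃)
    (hc₄ : 0 < c₄) (hcbar : 0 < cbar) (hq₀ : 0 < q₀) : ∃ C > 0, ∀ x q : ℝ, q₀ ≤ q →
      x ≤ cbar * q ^ 3 → ‖∫ ξ in Iic x, approxGreen c₃ c₄ ξ (q ^ 3)‖ ≤ C := by
  set ω₀ := c₃ / (288 * c₄) with hω₀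
  have hω₀pos : 0 < ω₀ := by positivity
  obtain ⟨C₁, hC₁, c₁, hc₁, h₁⟩ := exists_norm_integral_approxGreen_le_outer (cbar := 3 * c₃ * ω₀ ^ 2)
    (ymin := q₀ ^ 3) hc₃ hc₄ (by positivity) (by positivity)
  obtain ⟨C₂, hC₂, h₂⟩ := exists_norm_approxGreen_le_airy hc₃ hc₄ hq₀
  obtain ⟨C₃, hC₃, c, hc, h₃⟩ := exists_norm_approxGreen_le_right hc₃ hc₄ hcbar
  set κ := 1 / √(3 * c₃) with hκ
  have hκpos : 0 < κ := by positivity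
  set D := C₁ + 5 / (κ * √(c₃ * κ / 2)) with hD
  have hleft : ∀ x q : ℝ, q₀ ≤ q → x ≤ -q →
      ‖∫ ξ in Iic x, approxGreen c₃ c₄ ξ (q ^ 3)‖ ≤ D := by
    intro x q hq hx
    have hqpos : 0 < q := hq₀.trans_le hq
    rcases le_total x (-(3 * c₃ * ω₀ ^ 2 * q ^ 3)) with hx' | hx'
    · refine ((h₁ x (q ^ 3) (by gcongr)).1 hx').trans ?_
      have h4 : Real.exp (-(c₁ * (|x| ^ (4 / 3 : ℝ) / (q ^ 3) ^ (1 / 3 : ℝ)))) ≤ 1 := by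
        rw [Real.exp_le_one_iff, neg_nonpos]
        positivity
      have h5 : 0 ≤ 5 / (κ * √(c₃ * κ / 2)) := by positivity
      nlinarith
    · obtain ⟨ω, hω, hωω, hqω, rfl⟩ := exists_saddle_point hc₃ hω₀pos hqpos hx' hx
      have hsmall : 288 * c₄ * ω ≤ c₃ := by
        rw [hω₀, le_div_iff₀ (by positivity)] at hωω; linarith
      refine (norm_integral_approxGreen_saddle_le hc₃ hc₄ (by positivity) hω hsmall).trans ?_
      -- The saddle bound depends on `y` and `ω` only through `q ω`, which is at least `κ`.
      have h6 : κ * √(c₃ * κ / 2) ≤ ω * √(c₃ * q ^ 3 * ω / 2) := by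
        have h7 : ω * √(c₃ * q ^ 3 * ω / 2) = (q * ω) * √(c₃ * (q * ω) / 2) := by
          have : c₃ * q ^ 3 * ω / 2 = q ^ 2 * (c₃ * (q * ω) / 2) := by ring
          rw [this, Real.sqrt_mul (by positivity), Real.sqrt_sq hqpos.le]
          ring
        rw [h7]
        gcongr
      have h8 : 5 / (ω * √(c₃ * q ^ 3 * ω / 2)) ≤ 5 / (κ * √(c₃ * κ / 2)) := by gcongr
      linarith
  have hsplit : ∀ a b q : ℝ, 0 < q → ∫ ξ in Iic b, approxGreen c₃ c₄ ξ (q ^ 3) =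
      (∫ ξ in Iic a, approxGreen c₃ c₄ ξ (q ^ 3)) +
        ∫ ξ in a..b, approxGreen c₃ c₄ ξ (q ^ 3) := by
    intro a b q hq
    have hint := integrable_approxGreen hc₃ hc₄ (pow_pos hq 3)
    rw [← intervalIntegral.integral_Iic_sub_Iic hint.integrableOn hint.integrableOn]
    ring
  have hmid : ∀ x q : ℝ, q₀ ≤ q → |x| ≤ q →
      ‖∫ ξ in Iic x, approxGreen c₃ c₄ ξ (q ^ 3)‖ ≤ D + 2 * C₂ := by
    intro x q hq hx
    have hqpos : 0 < q := hq₀.trans_le hq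
    obtain ⟨hx1, hx2⟩ := abs_le.mp hx
    rw [hsplit (-q) x q hqpos]
    refine (norm_add_le _ _).trans (add_le_add (hleft (-q) q hq le_rfl) ?_)
    refine (intervalIntegral.norm_integral_le_of_norm_le_const (C := C₂ / q) fun ξ hξ => ?_).trans ?_
    · rw [uIoc_of_le hx1] at hξ
      exact h₂ ξ q hq (abs_le.mpr ⟨hξ.1.le, hξ.2.trans hx2⟩)
    · rw [abs_of_nonneg (by linarith), div_mul_eq_mul_div, div_le_iff₀ hqpos]
      nlinarith
  refine ⟨D + 2 * C₂ + C₃ / c, by positivity, fun x q hq hx => ?_⟩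
  have hqpos : 0 < q := hq₀.trans_le hq
  have hC₃c : 0 < C₃ / c := by positivity
  rcases le_total x (-q) with hx1 | hx1
  · linarith [hleft x q hq hx1]
  rcases le_total x q with hx2 | hx2
  · linarith [hmid x q hq (abs_le.mpr ⟨hx1, hx2⟩)]
  rw [hsplit q x q hqpos]
  refine (norm_add_le _ _).trans
    (add_le_add (hmid q q hq (by rw [abs_of_pos hqpos])) ?_)
  have hcq : -(c / q) < 0 := neg_neg_of_pos (by positivity)
  have hint := (integrableOn_exp_mul_Ioi hcq q).const_mul (C₃ / q)
  rw [intervalIntegral.integral_of_le hx2]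
  refine (norm_integral_le_of_norm_le (IntegrableOn.mono_set hint Ioc_subset_Ioi_self)
    ((ae_restrict_mem measurableSet_Ioc).mono fun ξ hξ => ?_)).trans
    ((setIntegral_mono_set hint (Eventually.of_forall fun ξ => by positivity)
      Ioc_subset_Ioi_self.eventuallyLE).trans ?_)
  · obtain ⟨s, hs, rfl⟩ := exists_eq_mul_sq (X := ξ) (y := q ^ 3) (by linarith [hξ.1])
      (by positivity)
    have hqs : 1 ≤ q * s := by
      have : q * 1 ≤ q * (q * s) ^ 2 := by linarith [hξ.1]
      have := le_of_mul_le_mul_left this hqpos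
      exact (one_le_sq_iff₀ (by positivity)).mp this
    have hsc : s ^ 2 ≤ cbar := by
      have : q ^ 3 * s ^ 2 ≤ q ^ 3 * cbar := by linarith [hξ.2]
      exact le_of_mul_le_mul_left this (by positivity)
    refine (h₃ s q hqpos hs hqs hsc).trans ?_
    gcongr
    -- Since `q s ≥ 1`, `(q s)³ ≥ (q s)² = ξ/q`; the resulting bound `(C₃/q) exp(-c ξ/q)` has
    -- integral at most `C₃/c`, uniformly in `q`.
    rw [neg_mul, neg_le_neg_iff, div_mul_eq_mul_div, div_le_iff₀ hqpos]
    have : c * (q ^ 3 * s ^ 2) * 1 ≤ c * (q ^ 3 * s ^ 2) * (q * s) := by gcongr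
    linarith
  · rw [integral_const_mul, integral_exp_mul_Ioi hcq, neg_div_neg_eq]
    have : Real.exp (-(c / q) * q) ≤ 1 := Real.exp_le_one_iff.mpr (by nlinarith)
    calc C₃ / q * (Real.exp (-(c / q) * q) / (c / q)) ≤ C₃ / q * (1 / (c / q)) := by gcongr
      _ = C₃ / c := by field_simp

/-! ### The pointwise and profile bounds in the variables `(x, y)` -/

theorem div_mul_exp_neg_mono {C C' c c' p t : ℝ} (hC : 0 ≤ C) (hCC : C ≤ C') (hcc : c' ≤ c)
    (hp : 0 < p) (ht : 0 ≤ t) :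
    C / p * Real.exp (-(c * t)) ≤ C' / p * Real.exp (-(c' * t)) := by
  have : 0 ≤ C' := hC.trans hCC
  gcongr

/-- Decay in the range `0 ≤ x ≤ c̄ y`. -/
theorem exists_norm_approxGreen_le_nonneg {c₃ c₄ cbar q₀ : ℝ} (hc₃ : 0 < c₃) (hc₄ : 0 < c₄)
    (hcbar : 0 < cbar) (hq₀ : 0 < q₀) : ∃ C > 0, ∃ c > 0, ∀ x q : ℝ, q₀ ≤ q → 0 ≤ x →
      x ≤ cbar * q ^ 3 → ‖approxGreen c₃ c₄ x (q ^ 3)‖ ≤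
        C / q * Real.exp (-(c * (x ^ (3 / 2 : ℝ) / (q ^ 3) ^ (1 / 2 : ℝ)))) := by
  obtain ⟨C₂, hC₂, h₂⟩ := exists_norm_approxGreen_le_airy hc₃ hc₄ hq₀
  obtain ⟨C₃, hC₃, c, hc, h₃⟩ := exists_norm_approxGreen_le_right hc₃ hc₄ hcbar
  refine ⟨max C₃ (C₂ * Real.exp c), lt_max_of_lt_left hC₃, c, hc, fun x q hq hx hxc => ?_⟩
  have hqpos : 0 < q := hq₀.trans_le hq
  obtain ⟨s, hs, rfl⟩ := exists_eq_mul_sq hx (pow_pos hqpos 3)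
  rw [mul_sq_rpow_div (pow_pos hqpos 3) hs]
  rcases le_total 1 (q * s) with hqs | hqs
  · have hsc : s ^ 2 ≤ cbar := by
      rw [mul_comm cbar] at hxc
      exact le_of_mul_le_mul_left hxc (by positivity)
    exact (h₃ s q hqpos hs hqs hsc).trans
      (div_mul_exp_neg_mono hC₃.le (le_max_left _ _) le_rfl hqpos (by positivity))
  · have hxq : |q ^ 3 * s ^ 2| ≤ q := by
      rw [abs_of_nonneg (by positivity)]
      calc q ^ 3 * s ^ 2 = q * (q * s) ^ 2 := by ring
        _ ≤ q * 1 := by gcongr; exact pow_le_one₀ (by positivity) hqs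
        _ = q := mul_one q
    have h1 : q ^ 3 * s ^ 3 ≤ 1 := by
      rw [← mul_pow]; exact pow_le_one₀ (by positivity) hqs
    refine (h₂ _ q hq hxq).trans ?_
    calc C₂ / q = C₂ * Real.exp c / q * Real.exp (-(c * 1)) := by
          rw [mul_one, Real.exp_neg]; field_simp
      _ ≤ max C₃ (C₂ * Real.exp c) / q * Real.exp (-(c * (q ^ 3 * s ^ 3))) := by
          gcongr
          exact le_max_right _ _

theorem norm_oscProfile_saddle_le {c₃ c₄ y ω : ℝ} (hc₃ : 0 < c₃) (hy : 0 < y) (hω : 0 < ω) :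
    ‖oscProfile c₃ c₄ (-(3 * c₃ * y * ω ^ 2)) y‖ ≤
      1 / √(2 * (c₃ * y * ω)) * Real.exp (-(c₄ * y * ω ^ 4)) := by
  have hβ : 0 < 2 * (c₃ * y * ω) := by positivity
  have h1 : ‖∫ t in (-(√2 * ω))..(√2 * ω), exp (-(I * (Real.pi / 4 : ℂ))) *
      (saddleAmplitude c₃ y ω t * exp (-(c₄ * y * ω ^ 4)))‖ ≤
      Real.exp (-(c₄ * y * ω ^ 4)) * (2 / √(2 * (c₃ * y * ω))) := by
    refine (norm_intervalIntegral_le_gaussian (by positivity) (Real.exp_pos _).le hβ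
      fun t ht => ?_).trans (by gcongr; exact sqrt_pi_div_le)
    have h2 : exp (-(c₄ * y * ω ^ 4) : ℂ) = ((Real.exp (-(c₄ * y * ω ^ 4)) : ℝ) : ℂ) := by
      push_cast; rfl
    rw [norm_mul, norm_exp_neg_I_pi_div_four, one_mul, norm_mul, h2, norm_real,
      Real.norm_of_nonneg (Real.exp_pos _).le, mul_comm]
    gcongr
    exact norm_saddleAmplitude_le hc₃ hy ((le_abs_self t).trans ht)
  have h3 : ‖(1 / (2 * Real.pi) : ℂ)‖ ≤ 1 / 2 := by
    have : (1 / (2 * Real.pi) : ℂ) = ((1 / (2 * Real.pi) : ℝ) : ℂ) := by push_cast; rfl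
    rw [this, norm_real, Real.norm_of_nonneg (by positivity)]
    have := Real.pi_gt_three
    gcongr
    linarith
  rw [oscProfile_saddle hc₃ hy hω, norm_mul]
  refine (mul_le_mul h3 h1 (norm_nonneg _) (by norm_num)).trans_eq ?_
  ring

/-- Trades exponential decay in `y` for the missing factor `y^(-1/4)` when the outer bound is used
inside the oscillating range. -/
theorem one_div_rpow_quarter_mul_exp_le {μ y : ℝ} (hμ : 0 < μ) (hy : 0 < y) :
    1 / y ^ (1 / 4 : ℝ) * Real.exp (-(μ * y)) ≤ 1 / μ ^ (1 / 4 : ℝ) / y ^ (1 / 2 : ℝ) := by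
  have hμy : 0 < μ * y := mul_pos hμ hy
  have h1 : μ ^ (1 / 4 : ℝ) * y ^ (1 / 4 : ℝ) ≤ Real.exp (μ * y) := by
    rw [← Real.mul_rpow hμ.le hy.le]
    calc (μ * y) ^ (1 / 4 : ℝ) ≤ (Real.exp (μ * y)) ^ (1 / 4 : ℝ) := by
          gcongr
          linarith [Real.add_one_le_exp (μ * y)]
      _ ≤ (Real.exp (μ * y)) ^ (1 : ℝ) :=
          Real.rpow_le_rpow_of_exponent_le (Real.one_le_exp hμy.le) (by norm_num)
      _ = Real.exp (μ * y) := Real.rpow_one _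
  have h2 : y ^ (1 / 2 : ℝ) = y ^ (1 / 4 : ℝ) * y ^ (1 / 4 : ℝ) := by
    rw [← Real.rpow_add hy]; norm_num
  rw [h2, Real.exp_neg, ← div_eq_mul_inv, div_div, div_div,
    div_le_div_iff₀ (by positivity) (by positivity), one_mul, one_mul]
  calc μ ^ (1 / 4 : ℝ) * (y ^ (1 / 4 : ℝ) * y ^ (1 / 4 : ℝ))
      = y ^ (1 / 4 : ℝ) * (μ ^ (1 / 4 : ℝ) * y ^ (1 / 4 : ℝ)) := by ring
    _ ≤ y ^ (1 / 4 : ℝ) * Real.exp (μ * y) := by gcongr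

theorem sq_mul_exp_neg_le {γ y ω : ℝ} (hγ : 0 < γ) (hy : 0 < y) :
    ω ^ 2 * Real.exp (-(2 * γ * y * ω ^ 4)) ≤
      1 / √γ / y ^ (1 / 2 : ℝ) * Real.exp (-(γ * y * ω ^ 4)) := by
  have hγy : 0 < γ * y := mul_pos hγ hy
  have h1 : √(γ * y) * ω ^ 2 ≤ Real.exp (γ * y * ω ^ 4) := by
    have h2 : (√(γ * y) * ω ^ 2) ^ 2 = γ * y * ω ^ 4 := by
      rw [mul_pow, Real.sq_sqrt hγy.le]; ring
    have := Real.add_one_le_exp (γ * y * ω ^ 4)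
    nlinarith [sq_nonneg (√(γ * y) * ω ^ 2 - 1)]
  have h3 : Real.exp (-(γ * y * ω ^ 4)) =
      Real.exp (γ * y * ω ^ 4) * Real.exp (-(2 * γ * y * ω ^ 4)) := by
    rw [← Real.exp_add]; congr 1; ring
  rw [h3, ← mul_assoc, ← Real.sqrt_eq_rpow, div_div, ← Real.sqrt_mul hγ.le]
  gcongr
  rw [one_div, ← div_eq_inv_mul, le_div_iff₀ (Real.sqrt_pos.mpr hγy), mul_comm]
  exact h1

theorem saddle_rpow_div {c₃ y ω : ℝ} (hc₃ : 0 < c₃) (hy : 0 < y) (hω : 0 < ω) :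
    |(-(3 * c₃ * y * ω ^ 2))| ^ (3 / 2 : ℝ) / y ^ (1 / 2 : ℝ) = √(3 * c₃) ^ 3 * (y * ω ^ 3) := by
  have h1 : |(-(3 * c₃ * y * ω ^ 2))| = y * (√(3 * c₃) * ω) ^ 2 := by
    rw [abs_neg, abs_of_pos (by positivity), mul_pow, Real.sq_sqrt (by positivity)]
    ring
  rw [h1, mul_sq_rpow_div hy (by positivity)]
  ring

/-- Comparison of the Green's function with the oscillating profile. -/
theorem exists_norm_approxGreen_sub_oscProfile_le {c₃ c₄ cbar : ℝ} (hc₃ : 0 < c₃)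
    (hc₄ : 0 < c₄) (hcbar : 0 < cbar) : ∃ C > 0, ∃ c > 0, ∀ x q : ℝ, 0 < q →
      -(cbar * q ^ 3) ≤ x → x ≤ -q →
      ‖approxGreen c₃ c₄ x (q ^ 3) - ((2 * (oscProfile c₃ c₄ x (q ^ 3)).re : ℝ) : ℂ)‖ ≤
        C / q * Real.exp (-(c * (|x| ^ (3 / 2 : ℝ) / (q ^ 3) ^ (1 / 2 : ℝ)))) +
        C / (q ^ 3) ^ (1 / 2 : ℝ) * Real.exp (-(c * (x ^ 2 / q ^ 3))) := by
  set ω₀ := c₃ / (288 * c₄) with hω₀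
  have hω₀pos : 0 < ω₀ := by positivity
  obtain ⟨Co, hCo, co, hco, hout⟩ := exists_norm_approxGreen_le_outer (cbar := 3 * c₃ * ω₀ ^ 2)
    hc₃ hc₄ (by positivity)
  obtain ⟨r₀, hr₀, hcr⟩ := exists_pos_cube_eq (show 0 < 3 * c₃ * ω₀ ^ 2 by positivity)
  set κ := 1 / √(3 * c₃) with hκ
  have hκpos : 0 < κ := by positivity
  set ω₁ := √(cbar / (3 * c₃)) with hω₁
  have hω₁pos : 0 < ω₁ := by positivity
  have hω₁sq : 3 * c₃ * ω₁ ^ 2 = cbar := by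
    rw [hω₁, Real.sq_sqrt (by positivity)]; field_simp
  -- When `ω ≥ ω₀`, half of the outer decay yields `exp(-μ y)`, since `|x| ≥ r₀³ y`; the other half
  -- yields `exp(-d₃ x²/y)`, since `x²/y ≤ cbar |x|`.
  set μ := co / 2 * (r₀ * r₀ ^ 3) with hμ
  have hμpos : 0 < μ := by positivity
  set K₁ := 2 / √(c₃ * κ / 2) with hK₁
  set K₂ := 72 * c₄ / c₃ * (1 / √(c₄ / 4)) with hK₂
  set K₃ := Co * (1 / μ ^ (1 / 4 : ℝ)) + 2 * (1 / √(2 * (c₃ * ω₀))) with hK₃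
  -- `d₁` and `d₂` rewrite `2 c₃ y ω³` and `c₄ y ω⁴ / 4` in terms of `x`; in the second, half of the
  -- available `c₄ y ω⁴ / 2` was spent on turning `ω²` into `y^(-1/2)`.
  set d₁ := 2 * c₃ / √(3 * c₃) ^ 3 with hd₁
  set d₂ := c₄ / 36 / c₃ ^ 2 with hd₂
  set d₃ := co / 2 * (r₀ / cbar) with hd₃
  have hK₁pos : 0 < K₁ := by positivity
  have hK₂pos : 0 < K₂ := by positivity
  have hK₃pos : 0 < K₃ := by positivity
  refine ⟨K₁ + K₂ + K₃, by positivity, min d₁ (min d₂ d₃),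
    lt_min (by positivity) (lt_min (by positivity) (by positivity)), fun x q hq hx hxq => ?_⟩
  have hy : 0 < q ^ 3 := pow_pos hq 3
  obtain ⟨ω, hω, hωω, hqω, rfl⟩ := exists_saddle_point (x := x) hc₃ hω₁pos hq
    (by rw [hω₁sq]; exact hx) hxq
  have hx2 : (-(3 * c₃ * q ^ 3 * ω ^ 2)) ^ 2 / q ^ 3 = 9 * c₃ ^ 2 * (q ^ 3 * ω ^ 4) := by
    field_simp
    ring
  have hle₁ : min d₁ (min d₂ d₃) ≤ d₁ := min_le_left _ _
  have hle₂ : min d₁ (min d₂ d₃) ≤ d₂ := (min_le_right _ _).trans (min_le_left _ _)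
  have hle₃ : min d₁ (min d₂ d₃) ≤ d₃ := (min_le_right _ _).trans (min_le_right _ _)
  rcases le_total ω ω₀ with hcase | hcase
  · have hsmall : 288 * c₄ * ω ≤ c₃ := by
      rw [hω₀, le_div_iff₀ (by positivity)] at hcase; linarith
    refine (norm_approxGreen_sub_oscProfile_le hc₃ hc₄ hy hω hsmall).trans (add_le_add ?_ ?_)
    · rw [saddle_rpow_div hc₃ hy hω]
      refine le_trans ?_ (div_mul_exp_neg_mono hK₁pos.le (by linarith) hle₁ hq (by positivity))
      have h1 : √(c₃ * κ / 2) * q ≤ √(c₃ * q ^ 3 * ω / 2) := by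
        have : c₃ * q ^ 3 * ω / 2 = c₃ * (q * ω) / 2 * q ^ 2 := by ring
        rw [this, Real.sqrt_mul (by positivity), Real.sqrt_sq hq.le]
        gcongr
      have h2 : d₁ * (√(3 * c₃) ^ 3 * (q ^ 3 * ω ^ 3)) = 2 * c₃ * q ^ 3 * ω ^ 3 := by
        rw [hd₁]; field_simp
      rw [h2, hK₁, div_div]
      gcongr
    · rw [hx2]
      refine le_trans ?_ (div_mul_exp_neg_mono hK₂pos.le (by linarith) hle₂ (by positivity)
        (by positivity))
      have h1 := sq_mul_exp_neg_le (γ := c₄ / 4) (ω := ω) (by positivity) hy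
      have h2 : d₂ * (9 * c₃ ^ 2 * (q ^ 3 * ω ^ 4)) = c₄ / 4 * q ^ 3 * ω ^ 4 := by
        rw [hd₂]; field_simp; norm_num
      rw [h2, hK₂, mul_assoc]
      calc 72 * c₄ / c₃ * (ω ^ 2 * Real.exp (-(c₄ / 2 * q ^ 3 * ω ^ 4)))
          = 72 * c₄ / c₃ * (ω ^ 2 * Real.exp (-(2 * (c₄ / 4) * q ^ 3 * ω ^ 4))) := by
            congr 4; ring
        _ ≤ 72 * c₄ / c₃ * (1 / √(c₄ / 4) / (q ^ 3) ^ (1 / 2 : ℝ) *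
              Real.exp (-(c₄ / 4 * q ^ 3 * ω ^ 4))) := by gcongr
        _ = _ := by ring
  -- Away from small `ω` no cancellation is needed: `G` and the profile each fit into the second
  -- error term.
  · set x := -(3 * c₃ * q ^ 3 * ω ^ 2) with hxdef
    have hxabs : |x| = 3 * c₃ * q ^ 3 * ω ^ 2 := by
      rw [hxdef, abs_neg, abs_of_pos (by positivity)]
    have hxlow : 3 * c₃ * ω₀ ^ 2 * q ^ 3 ≤ |x| := by
      rw [hxabs]
      have : 3 * c₃ * q ^ 3 * ω₀ ^ 2 ≤ 3 * c₃ * q ^ 3 * ω ^ 2 := by gcongr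
      linarith
    have hxup : |x| ≤ cbar * q ^ 3 := by
      rw [hxabs]
      linarith
    have hfirst : 0 ≤ (K₁ + K₂ + K₃) / q *
        Real.exp (-(min d₁ (min d₂ d₃) * (|x| ^ (3 / 2 : ℝ) / (q ^ 3) ^ (1 / 2 : ℝ)))) := by
      positivity
    have hG : ‖approxGreen c₃ c₄ x (q ^ 3)‖ ≤ Co * (1 / μ ^ (1 / 4 : ℝ)) /
        (q ^ 3) ^ (1 / 2 : ℝ) * Real.exp (-(min d₁ (min d₂ d₃) * (x ^ 2 / q ^ 3))) := by
      refine (hout x (q ^ 3) hy hxlow).trans ?_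
      have h1 := mul_abs_le_rpow_div (ξ := x) hr₀.le hy (by rw [← hcr]; exact hxlow)
      have h2 : x ^ 2 / q ^ 3 ≤ cbar * |x| := by
        rw [div_le_iff₀ hy, ← sq_abs]
        nlinarith [mul_le_mul_of_nonneg_left hxup (abs_nonneg x)]
      have h3 : min d₁ (min d₂ d₃) * (x ^ 2 / q ^ 3) ≤ co / 2 * (r₀ * |x|) := by
        calc min d₁ (min d₂ d₃) * (x ^ 2 / q ^ 3) ≤ d₃ * (cbar * |x|) := by gcongr
          _ = co / 2 * (r₀ * |x|) := by rw [hd₃]; field_simp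
      have h4 : μ * q ^ 3 ≤ co / 2 * (r₀ * |x|) := by
        rw [hμ, mul_assoc, mul_assoc, ← hcr]
        gcongr
      have h5 := mul_le_mul_of_nonneg_left h1 hco.le
      calc Co / (q ^ 3) ^ (1 / 4 : ℝ) *
            Real.exp (-(co * (|x| ^ (4 / 3 : ℝ) / (q ^ 3) ^ (1 / 3 : ℝ))))
          ≤ Co / (q ^ 3) ^ (1 / 4 : ℝ) * Real.exp (-(μ * q ^ 3) +
              -(min d₁ (min d₂ d₃) * (x ^ 2 / q ^ 3))) := by
            gcongr
            linarith
        _ = Co * (1 / (q ^ 3) ^ (1 / 4 : ℝ) * Real.exp (-(μ * q ^ 3))) *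
              Real.exp (-(min d₁ (min d₂ d₃) * (x ^ 2 / q ^ 3))) := by
            rw [Real.exp_add]; ring
        _ ≤ Co * (1 / μ ^ (1 / 4 : ℝ) / (q ^ 3) ^ (1 / 2 : ℝ)) *
              Real.exp (-(min d₁ (min d₂ d₃) * (x ^ 2 / q ^ 3))) :=
            mul_le_mul_of_nonneg_right (mul_le_mul_of_nonneg_left
              (one_div_rpow_quarter_mul_exp_le hμpos hy) hCo.le) (Real.exp_pos _).le
        _ = _ := by ring
    have hosc : ‖((2 * (oscProfile c₃ c₄ x (q ^ 3)).re : ℝ) : ℂ)‖ ≤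
        2 * (1 / √(2 * (c₃ * ω₀))) / (q ^ 3) ^ (1 / 2 : ℝ) *
          Real.exp (-(min d₁ (min d₂ d₃) * (x ^ 2 / q ^ 3))) := by
      rw [norm_real, norm_mul, Real.norm_of_nonneg zero_le_two]
      have h1 := (abs_re_le_norm _).trans (norm_oscProfile_saddle_le (c₄ := c₄) hc₃ hy hω)
      have h2 : √(2 * (c₃ * ω₀)) * (q ^ 3) ^ (1 / 2 : ℝ) ≤ √(2 * (c₃ * q ^ 3 * ω)) := by
        rw [← Real.sqrt_eq_rpow, ← Real.sqrt_mul (by positivity)]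
        apply Real.sqrt_le_sqrt
        have : c₃ * q ^ 3 * ω₀ ≤ c₃ * q ^ 3 * ω := by gcongr
        linarith
      have h3 : min d₁ (min d₂ d₃) * (x ^ 2 / q ^ 3) ≤ c₄ * q ^ 3 * ω ^ 4 := by
        have h4 : d₂ * (9 * c₃ ^ 2 * (q ^ 3 * ω ^ 4)) = c₄ / 4 * q ^ 3 * ω ^ 4 := by
          rw [hd₂]; field_simp; norm_num
        have h5 : min d₁ (min d₂ d₃) * (9 * c₃ ^ 2 * (q ^ 3 * ω ^ 4)) ≤
          d₂ * (9 * c₃ ^ 2 * (q ^ 3 * ω ^ 4)) := by gcongr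
        have h6 : 0 < c₄ * q ^ 3 * ω ^ 4 := by positivity
        rw [hx2]
        linarith
      calc 2 * ‖(oscProfile c₃ c₄ x (q ^ 3)).re‖
          ≤ 2 * (1 / (√(2 * (c₃ * ω₀)) * (q ^ 3) ^ (1 / 2 : ℝ)) *
            Real.exp (-(min d₁ (min d₂ d₃) * (x ^ 2 / q ^ 3)))) := by
            gcongr
            refine h1.trans ?_
            gcongr
        _ = _ := by field_simp
    refine (norm_sub_le _ _).trans ((add_le_add hG hosc).trans ?_)
    rw [← add_mul, ← add_div]
    have hlast : K₃ / (q ^ 3) ^ (1 / 2 : ℝ) *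
        Real.exp (-(min d₁ (min d₂ d₃) * (x ^ 2 / q ^ 3))) ≤ (K₁ + K₂ + K₃) /
        (q ^ 3) ^ (1 / 2 : ℝ) * Real.exp (-(min d₁ (min d₂ d₃) * (x ^ 2 / q ^ 3))) :=
      div_mul_exp_neg_mono hK₃pos.le (by linarith) le_rfl (by positivity) (by positivity)
    linarith

end

/-! ### Assembly for the Lax–Wendroff coefficients. -/

theorem lwC3_pos {α : ℝ} (hα₀ : 0 < α) (hα₁ : α < 1) : 0 < lwC3 α := by
  have : 0 < 1 - α ^ 2 := by nlinarith
  unfold lwC3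
  positivity

theorem lwC4_pos {α : ℝ} (hα₀ : 0 < α) (hα₁ : α < 1) : 0 < lwC4 α := by
  have : 0 < 1 - α ^ 2 := by nlinarith
  unfold lwC4
  positivity

theorem mainTheorem8 (α : ℝ) (hα₀ : 0 < α) (hα₁ : α < 1)
    (ymin : ℝ) (hymin : 0 < ymin) (cbar : ℝ) (hcbar : 0 < cbar) :
    ∃ C > 0, ∃ c > 0,
      (∀ x y : ℝ, ymin ≤ y →
        (cbar * y ≤ x →
          ‖approxGreen (lwC3 α) (lwC4 α) x y‖ ≤
            C / y ^ (1 / 4 : ℝ) * Real.exp (-(c * (x ^ (4 / 3 : ℝ) / y ^ (1 / 3 : ℝ))))) ∧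
        (0 ≤ x → x ≤ cbar * y →
          ‖approxGreen (lwC3 α) (lwC4 α) x y‖ ≤
            C / y ^ (1 / 3 : ℝ) * Real.exp (-(c * (x ^ (3 / 2 : ℝ) / y ^ (1 / 2 : ℝ))))) ∧
        (-y ^ (1 / 3 : ℝ) ≤ x → x ≤ 0 →
          ‖approxGreen (lwC3 α) (lwC4 α) x y‖ ≤ C / y ^ (1 / 3 : ℝ)) ∧
        (x ≤ -(cbar * y) →
          ‖approxGreen (lwC3 α) (lwC4 α) x y‖ ≤
            C / y ^ (1 / 4 : ℝ) * Real.exp (-(c * (|x| ^ (4 / 3 : ℝ) / y ^ (1 / 3 : ℝ))))) ∧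
        (-(cbar * y) ≤ x → x ≤ -y ^ (1 / 3 : ℝ) →
          ‖approxGreen (lwC3 α) (lwC4 α) x y
              - ((2 * (oscProfile (lwC3 α) (lwC4 α) x y).re : ℝ) : ℂ)‖ ≤
            C / y ^ (1 / 3 : ℝ) * Real.exp (-(c * (|x| ^ (3 / 2 : ℝ) / y ^ (1 / 2 : ℝ)))) +
            C / y ^ (1 / 2 : ℝ) * Real.exp (-(c * (x ^ 2 / y))))) ∧
      ∃ C' ≥ C, ∃ c' > 0, c' ≤ c ∧
        ∀ x y : ℝ, ymin ≤ y →
          IntegrableOn (fun ξ : ℝ => approxGreen (lwC3 α) (lwC4 α) ξ y) (Set.Iic x) ∧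
          (x ≤ -(cbar * y) →
            ‖∫ ξ in Set.Iic x, approxGreen (lwC3 α) (lwC4 α) ξ y‖ ≤
              C' * Real.exp (-(c' * (|x| ^ (4 / 3 : ℝ) / y ^ (1 / 3 : ℝ))))) ∧
          (-(cbar * y) ≤ x → x ≤ cbar * y →
            ‖∫ ξ in Set.Iic x, approxGreen (lwC3 α) (lwC4 α) ξ y‖ ≤ C') ∧
          (cbar * y ≤ x →
            ‖1 - ∫ ξ in Set.Iic x, approxGreen (lwC3 α) (lwC4 α) ξ y‖ ≤
              C' * Real.exp (-(c' * (x ^ (4 / 3 : ℝ) / y ^ (1 / 3 : ℝ))))) := by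
  have hc₃ := lwC3_pos hα₀ hα₁
  have hc₄ := lwC4_pos hα₀ hα₁
  -- From here on only the positivity of the two coefficients matters.
  generalize lwC3 α = c₃ at *
  generalize lwC4 α = c₄ at *
  have hq₀ : 0 < ymin ^ (1 / 3 : ℝ) := by positivity
  obtain ⟨C₁, hC₁, c₁, hc₁, h₁⟩ := exists_norm_approxGreen_le_outer hc₃ hc₄ hcbar
  obtain ⟨C₂, hC₂, h₂⟩ := exists_norm_approxGreen_le_airy hc₃ hc₄ hq₀
  obtain ⟨C₃, hC₃, c₃', hc₃', h₃⟩ := exists_norm_approxGreen_le_nonneg hc₃ hc₄ hcbar hq₀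
  obtain ⟨C₄, hC₄, c₄', hc₄', h₄⟩ := exists_norm_approxGreen_sub_oscProfile_le hc₃ hc₄ hcbar
  obtain ⟨C₅, hC₅, c₅, hc₅, h₅⟩ :=
    exists_norm_integral_approxGreen_le_outer hc₃ hc₄ hcbar hymin
  obtain ⟨C₆, hC₆, h₆⟩ := exists_norm_integral_approxGreen_le hc₃ hc₄ hcbar hq₀
  have hcube : ∀ y : ℝ, 0 < y → (y ^ (1 / 3 : ℝ)) ^ 3 = y := by
    intro y hy
    rw [← Real.rpow_natCast, ← Real.rpow_mul hy.le]
    norm_num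
  set c := min c₁ (min c₃' c₄') with hc
  have hcpos : 0 < c := lt_min hc₁ (lt_min hc₃' hc₄')
  have hcle₁ : c ≤ c₁ := min_le_left _ _
  have hcle₃ : c ≤ c₃' := (min_le_right _ _).trans (min_le_left _ _)
  have hcle₄ : c ≤ c₄' := (min_le_right _ _).trans (min_le_right _ _)
  refine ⟨C₁ + C₂ + C₃ + C₄, by positivity, c, hcpos, fun x y hy => ?_,
    C₁ + C₂ + C₃ + C₄ + C₅ + C₆, by linarith, min c c₅, lt_min hcpos hc₅, min_le_left _ _,
    fun x y hy => ?_⟩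
  · have hypos : 0 < y := hymin.trans_le hy
    have hqpos : 0 < y ^ (1 / 3 : ℝ) := by positivity
    have hqq : ymin ^ (1 / 3 : ℝ) ≤ y ^ (1 / 3 : ℝ) := by gcongr
    have hqy := hcube y hypos
    refine ⟨fun hx => ?_, fun hx0 hx => ?_, fun hx hx0 => ?_, fun hx => ?_, fun hx hxq => ?_⟩
    · have hx0 : 0 ≤ x := le_trans (by positivity) hx
      have h := h₁ x y hypos (by rwa [abs_of_nonneg hx0])
      rw [abs_of_nonneg hx0] at h
      exact h.trans (div_mul_exp_neg_mono hC₁.le (by linarith) hcle₁ (by positivity)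
        (by positivity))
    · have h := h₃ x _ hqq hx0 (by rwa [hqy])
      rw [hqy] at h
      exact h.trans (div_mul_exp_neg_mono hC₃.le (by linarith) hcle₃ hqpos (by positivity))
    · have h := h₂ x _ hqq (abs_le.mpr ⟨hx, hx0.trans hqpos.le⟩)
      rw [hqy] at h
      refine h.trans ?_
      gcongr
      linarith
    · have hx0 : x ≤ 0 := hx.trans (neg_nonpos.mpr (by positivity))
      exact (h₁ x y hypos (by rw [abs_of_nonpos hx0]; linarith)).trans
        (div_mul_exp_neg_mono hC₁.le (by linarith) hcle₁ (by positivity) (by positivity))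
    · have h := h₄ x _ hqpos (by rwa [hqy]) hxq
      rw [hqy] at h
      exact h.trans (add_le_add
        (div_mul_exp_neg_mono hC₄.le (by linarith) hcle₄ hqpos (by positivity))
        (div_mul_exp_neg_mono hC₄.le (by linarith) hcle₄ (by positivity) (by positivity)))
  · have hypos : 0 < y := hymin.trans_le hy
    have hqq : ymin ^ (1 / 3 : ℝ) ≤ y ^ (1 / 3 : ℝ) := by gcongr
    have hqy := hcube y hypos
    have hmono : C₅ * Real.exp (-(c₅ * (|x| ^ (4 / 3 : ℝ) / y ^ (1 / 3 : ℝ)))) ≤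
        (C₁ + C₂ + C₃ + C₄ + C₅ + C₆) *
          Real.exp (-(min c c₅ * (|x| ^ (4 / 3 : ℝ) / y ^ (1 / 3 : ℝ)))) := by
      have h := div_mul_exp_neg_mono (C' := C₁ + C₂ + C₃ + C₄ + C₅ + C₆)
        (t := |x| ^ (4 / 3 : ℝ) / y ^ (1 / 3 : ℝ)) hC₅.le (by linarith) (min_le_right c c₅)
        one_pos (by positivity)
      rwa [div_one, div_one] at h
    have hint := integrable_approxGreen hc₃ hc₄ hypos
    refine ⟨hint.integrableOn, fun hx => ((h₅ x y hy).1 hx).trans hmono, fun _ hx => ?_,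
      fun hx => ?_⟩
    · have h := h₆ x _ hqq (by rwa [hqy])
      rw [hqy] at h
      linarith
    · have hx0 : 0 ≤ x := le_trans (by positivity) hx
      -- Unit mass turns the quantity into the integral over `(x, ∞)`, where the pointwise decay
      -- applies.
      rw [← integral_approxGreen hc₃ hc₄ hypos,
        ← intervalIntegral.integral_Iic_add_Ioi (b := x) hint.integrableOn hint.integrableOn,
        add_sub_cancel_left]
      have h := ((h₅ x y hy).2 hx).2.trans hmono
      rwa [abs_of_nonneg hx0] at h
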